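/- Corollary 5.4 (Ambarzumyan). Let $J=\begin{pmatrix}0&1\\-1&0\end{pmatrix}$, $\sigma_0=\mathbb I=\begin{pmatrix}1&0\\0&1\end{pmatrix}$ and $\sigma_2=iJ=\begin{pmatrix}0&i\\-i&0\end{pmatrix}$. Let $Q:\mathbb R\to M_2(\mathbb C)$ be integrable on $[0,\pi)$ (entrywise, for Lebesgue measure) and such that $Q(x)$ is Hermitian and $Q(x+\pi)=Q(x)$ for almost every $x\in\mathbb R$. For $\lambda\in\mathbb C$ let $\mathbb Y(\cdot,\lambda):\mathbb R\to M_2(\mathbb C)$ be the unique locally absolutely continuous matrix function with $$J\,\mathbb Y'(x)+Q(x)\,\mathbb Y(x)=\lambda\,\mathbb Y(x)\quad\text{for almost every }x\in\mathbb R,\qquad \mathbb Y(0)=\mathbb I,$$ and let $\Delta(\lambda)=\operatorname{tr}\mathbb Y(\pi,\lambda)$ be the discriminant. Put $\mathcal S=\{\lambda\in\mathbb R:|\Delta(\lambda)|\le 2\}$; the instability intervals are the connected components of $\mathbb R\setminus\mathcal S$. Then every instability interval vanishes (that is, there is none: $\mathcal S=\mathbb R$) if and only if there are real-valued functions $r,q$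 on $\mathbb R$, integrable on $[0,\pi)$, such that $$Q(x)=r(x)\,\sigma_0+q(x)\,\sigma_2\quad\text{for almost every }x\in\mathbb R.$$ -/

import Mathlib

open MeasureTheory

namespace DiracSystem

/-- The symplectic matrix `J` of the expression `ℓ Y = J Y' + Q Y`. -/
def J : Matrix (Fin 2) (Fin 2) ℂ := !![0, 1; -1, 0]

/-- The Pauli matrix `σ₀`, the identity. -/
def sigma0 : Matrix (Fin 2) (Fin 2) ℂ := 1

/-- The Pauli matrix `σ₂`, with the sign convention `σ₂ = i J`. -/
def sigma2 : Matrix (Fin 2) (Fin 2) ℂ := !![0, Complex.I; -Complex.I, 0]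

/-- `Y` is the fundamental matrix of `J Y' + Q Y = lam Y` on the real line normalized by
`Y 0 = 1`: its entries are locally absolutely continuous, and the equation holds for almost
every `x` (where all the entries are differentiable, since they are absolutely continuous). -/
structure IsFundamentalMatrix (Q : ℝ → Matrix (Fin 2) (Fin 2) ℂ) (lam : ℂ)
    (Y : ℝ → Matrix (Fin 2) (Fin 2) ℂ) : Prop where
  initial : Y 0 = 1
  absolutelyContinuous : ∀ (i j : Fin 2) (a b : ℝ),
    AbsolutelyContinuousOnInterval (fun x => Y x i j) a b
  equation : ∀ᵐ x : ℝ, J * (Matrix.of fun i j => deriv (fun t => Y t i j) x) + Q x * Y x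
    = lam • Y x

/-- `d` is the value `Δ(lam)` of the discriminant, that is, the trace `y₁₁(π) + y₂₂(π)` of the
(unique) normalized fundamental matrix at `π`. -/
def IsDiscriminant (Q : ℝ → Matrix (Fin 2) (Fin 2) ℂ) (lam d : ℂ) : Prop :=
  ∃ Y : ℝ → Matrix (Fin 2) (Fin 2) ℂ,
    IsFundamentalMatrix Q lam Y ∧ d = (Y Real.pi).trace

/-- The set `{lam ∈ ℝ : |Δ(lam)| ≤ 2}`. -/
def stabilitySet (Q : ℝ → Matrix (Fin 2) (Fin 2) ℂ) : Set ℝ :=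
  {lam | ∃ d : ℂ, IsDiscriminant Q (lam : ℂ) d ∧ ‖d‖ ≤ 2}

/-- The instability intervals: the connected components of the complement in `ℝ` of
`stabilitySet Q`. -/
def instabilityIntervals (Q : ℝ → Matrix (Fin 2) (Fin 2) ℂ) : Set (Set ℝ) :=
  {I | ∃ lam ∈ (stabilitySet Q)ᶜ, I = connectedComponentIn (stabilitySet Q)ᶜ lam}

/-- Every instability interval vanishes. A component of a set is never empty, so this says that
there is none. -/
def AllInstabilityIntervalsVanish (Q : ℝ → Matrix (Fin 2) (Fin 2) ℂ) : Prop :=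
  instabilityIntervals Q = ∅

end DiracSystem

/-! ### Calculus of absolutely continuous complex functions. -/

namespace DiracSystem

open Set Filter Topology ComplexConjugate

/-! In the eigenbasis of `J` a Hermitian potential has two real diagonal entries and one complex
off-diagonal entry, and the latter vanishes exactly for `r σ₀ + q σ₂`. Integrating factors remove
the diagonal and leave `a' = g e^{2iλx} b`, `b' = conj (g e^{2iλx}) a`, `a 0 = 1`, `b 0 = 0`, which
conserves `|a|² - |b|² = 1`. With `T = π` and a real constant `c`, the discriminant is, up to a
unimodular factor, `2 Re A(λ)` with `A(λ) = e^{ic} e^{-iλT} a(T)`. Stability everywhere thus says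
that `f = Re A` satisfies `|f| ≤ 1` on the real line, and the claim is that this forces `g = 0`.

Two facts about `f` compete. Locally, it moves at least as fast as a cosine of frequency `T`:
differentiation in `λ` (`hasDerivAt_conj_phase_mul_left`) gives `|f'| ≥ ∫ (h y - B j)` with `h =
|a|² + |b|²`, `j = 2|a||b|`, `y = |Im A|`, `B = |b(T)|`. Since `h² - j² = 1`, the integrand is at
least `√(y² - B²) = √(1 - f²)`. Globally, it cannot gain on the cosine: by the Riemann–Lebesgue
lemma the phase of `A` is asymptotic to that of `e^{i(c - λT)}` at both ends (`tendsto_logLeft`).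
Hence the extrema of `f` are spaced exactly as those of the cosine
(`exists_deriv_eq_of_phase_asymptotic`), equality holds in the speed estimate at some `λ`, and this
forces `b = 0` on `[0, T]` (`right_eq_zero_of_integral_speed_le`), so `g = 0` almost everywhere.

Conversely, `σ₀` and `σ₂` commute with `J`, so the system is solved by explicit exponentials and the
discriminant is a sum of two unimodular numbers (`exists_isFundamentalMatrix`). -/

theorem _root_.LipschitzOnWith.comp_absolutelyContinuousOnInterval {X Z : Type*}
    [PseudoMetricSpace X] [PseudoMetricSpace Z] {φ : X → Z} {K : NNReal} {s : Set X} {u : ℝ → X}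
    {a b : ℝ} (hφ : LipschitzOnWith K φ s) (hu : AbsolutelyContinuousOnInterval u a b)
    (hs : MapsTo u (uIcc a b) s) : AbsolutelyContinuousOnInterval (fun x => φ (u x)) a b := by
  have h := Tendsto.const_mul (K : ℝ) hu
  rw [mul_zero] at h
  refine squeeze_zero' (Eventually.of_forall fun E => Finset.sum_nonneg fun i _ => dist_nonneg)
    ?_ h
  rw [eventually_inf_principal]
  refine Eventually.of_forall fun E hE => ?_
  rw [Finset.mul_sum]
  refine Finset.sum_le_sum fun i hi => ?_
  exact hφ.dist_le_mul _ (hs (hE.1 i hi).1) _ (hs (hE.1 i hi).2)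

theorem _root_.LipschitzWith.comp_absolutelyContinuousOnInterval {X Z : Type*}
    [PseudoMetricSpace X] [PseudoMetricSpace Z] {φ : X → Z} {K : NNReal} {u : ℝ → X}
    {a b : ℝ} (hφ : LipschitzWith K φ) (hu : AbsolutelyContinuousOnInterval u a b) :
    AbsolutelyContinuousOnInterval (fun x => φ (u x)) a b :=
  (hφ.lipschitzOnWith (s := univ)).comp_absolutelyContinuousOnInterval hu (mapsTo_univ _ _)

/-- The complex-valued function `u` is absolutely continuous on `[a, b]` with derivative `u'`
almost everywhere. -/
structure HasACDeriv (u u' : ℝ → ℂ) (a b : ℝ) : Prop where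
  ac : AbsolutelyContinuousOnInterval u a b
  deriv : ∀ᵐ x : ℝ, x ∈ uIcc a b → HasDerivAt u (u' x) x

section complexAC

variable {u : ℝ → ℂ} {a b : ℝ}

theorem ac_re (hu : AbsolutelyContinuousOnInterval u a b) :
    AbsolutelyContinuousOnInterval (fun x => (u x).re) a b :=
  (Complex.reCLM.lipschitz).comp_absolutelyContinuousOnInterval hu

theorem ac_im (hu : AbsolutelyContinuousOnInterval u a b) :
    AbsolutelyContinuousOnInterval (fun x => (u x).im) a b :=
  (Complex.imCLM.lipschitz).comp_absolutelyContinuousOnInterval hu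

theorem ac_ofReal {v : ℝ → ℝ} (hv : AbsolutelyContinuousOnInterval v a b) :
    AbsolutelyContinuousOnInterval (fun x => (v x : ℂ)) a b :=
  (Complex.ofRealCLM.lipschitz).comp_absolutelyContinuousOnInterval hv

theorem ae_hasDerivAt_deriv_of_ac (hu : AbsolutelyContinuousOnInterval u a b) :
    ∀ᵐ x : ℝ, x ∈ uIcc a b → HasDerivAt u (deriv u x) x := by
  filter_upwards [(ac_re hu).ae_differentiableAt, (ac_im hu).ae_differentiableAt] with x h1 h2 hx
  have h := ((h1 hx).hasDerivAt.ofReal_comp).add (((h2 hx).hasDerivAt.ofReal_comp).mul_const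
    Complex.I)
  have h' : DifferentiableAt ℝ u x := by
    convert! h.differentiableAt using 1
    ext y
    simp [Complex.re_add_im]
  exact h'.hasDerivAt

theorem intervalIntegrable_of_ac {u' : ℝ → ℂ} (hu : HasACDeriv u u' a b) :
    IntervalIntegrable u' volume a b := by
  have h1 := (ac_re hu.ac).intervalIntegrable_deriv
  have h2 := (ac_im hu.ac).intervalIntegrable_deriv
  have h3 : IntervalIntegrable (fun x => ((deriv (fun x => (u x).re) x : ℝ) : ℂ)
      + ((deriv (fun x => (u x).im) x : ℝ) : ℂ) * Complex.I) volume a b := by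
    refine IntervalIntegrable.add ?_ (IntervalIntegrable.mul_const ?_ _)
    · exact ⟨h1.1.ofReal, h1.2.ofReal⟩
    · exact ⟨h2.1.ofReal, h2.2.ofReal⟩
  refine h3.congr_ae ?_
  refine (ae_restrict_iff' measurableSet_uIoc).2 ?_
  filter_upwards [hu.deriv] with x hx hx'
  have h := hx (uIoc_subset_uIcc hx')
  have e1 : HasDerivAt (fun x => (u x).re) (u' x).re x :=
    (Complex.reCLM.hasFDerivAt.comp_hasDerivAt x h)
  have e2 : HasDerivAt (fun x => (u x).im) (u' x).im x :=
    (Complex.imCLM.hasFDerivAt.comp_hasDerivAt x h)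
  rw [e1.deriv, e2.deriv, Complex.re_add_im]

end complexAC

namespace HasACDeriv

variable {u v u' v' : ℝ → ℂ} {a b : ℝ}

theorem congr_deriv (hu : HasACDeriv u u' a b) (h : ∀ᵐ x : ℝ, x ∈ uIcc a b → u' x = v' x) :
    HasACDeriv u v' a b := by
  refine ⟨hu.ac, ?_⟩
  filter_upwards [hu.deriv, h] with x h1 h2 hx
  rw [← h2 hx]
  exact h1 hx

theorem mono {c d : ℝ} (hu : HasACDeriv u u' a b) (h : uIcc c d ⊆ uIcc a b) :
    HasACDeriv u u' c d := by
  refine ⟨hu.ac.mono h, ?_⟩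
  filter_upwards [hu.deriv] with x h1 hx using h1 (h hx)

theorem of_hasDerivAt (h : ∀ x, HasDerivAt u (u' x) x) (hc : Continuous u') :
    HasACDeriv u u' a b := by
  refine ⟨?_, Eventually.of_forall fun x _ => h x⟩
  have h1 : ContDiff ℝ 1 u := by
    rw [contDiff_one_iff_deriv]
    refine ⟨fun x => (h x).differentiableAt, ?_⟩
    have : _root_.deriv u = u' := funext fun x => (h x).deriv
    rwa [this]
  exact h1.contDiffOn.absolutelyContinuousOnInterval

theorem add (hu : HasACDeriv u u' a b) (hv : HasACDeriv v v' a b) :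
    HasACDeriv (fun x => u x + v x) (fun x => u' x + v' x) a b := by
  refine ⟨hu.ac.fun_add hv.ac, ?_⟩
  filter_upwards [hu.deriv, hv.deriv] with x h1 h2 hx using (h1 hx).add (h2 hx)

theorem sub (hu : HasACDeriv u u' a b) (hv : HasACDeriv v v' a b) :
    HasACDeriv (fun x => u x - v x) (fun x => u' x - v' x) a b := by
  refine ⟨hu.ac.fun_sub hv.ac, ?_⟩
  filter_upwards [hu.deriv, hv.deriv] with x h1 h2 hx using (h1 hx).sub (h2 hx)

theorem mul (hu : HasACDeriv u u' a b) (hv : HasACDeriv v v' a b) :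
    HasACDeriv (fun x => u x * v x) (fun x => u' x * v x + u x * v' x) a b := by
  refine ⟨hu.ac.fun_smul hv.ac, ?_⟩
  filter_upwards [hu.deriv, hv.deriv] with x h1 h2 hx using (h1 hx).mul (h2 hx)

theorem const_mul (c : ℂ) (hu : HasACDeriv u u' a b) :
    HasACDeriv (fun x => c * u x) (fun x => c * u' x) a b := by
  refine ⟨hu.ac.const_smul c, ?_⟩
  filter_upwards [hu.deriv] with x h1 hx using (h1 hx).const_mul c

theorem conjugate (hu : HasACDeriv u u' a b) :
    HasACDeriv (fun x => conj (u x)) (fun x => conj (u' x)) a b := by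
  refine ⟨Complex.conjCLE.lipschitz.comp_absolutelyContinuousOnInterval hu.ac, ?_⟩
  filter_upwards [hu.deriv] with x h1 hx using (h1 hx).star

theorem cexp (hu : HasACDeriv u u' a b) :
    HasACDeriv (fun x => Complex.exp (u x)) (fun x => Complex.exp (u x) * u' x) a b := by
  -- The exponential is not globally Lipschitz, but it is so on a ball that contains the values of
  -- `u` on the interval.
  obtain ⟨C, hC⟩ := hu.ac.exists_bound
  have h1 : ContDiffOn ℝ 1 Complex.exp (Metric.closedBall (0 : ℂ) C) :=
    Complex.contDiff_exp.contDiffOn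
  obtain ⟨K, hK⟩ := h1.exists_lipschitzOnWith (by decide) (convex_closedBall _ _)
    (isCompact_closedBall _ _)
  refine ⟨hK.comp_absolutelyContinuousOnInterval hu.ac fun x hx => by simpa using hC x hx, ?_⟩
  filter_upwards [hu.deriv] with x h1 hx using (h1 hx).cexp

theorem intervalIntegral {f : ℝ → ℂ} {c : ℝ} (hf : IntervalIntegrable f volume a b)
    (hc : c ∈ uIcc a b) : HasACDeriv (fun x => ∫ t in c..x, f t) f a b := by
  have hre : IntervalIntegrable (fun t => (f t).re) volume a b := ⟨hf.1.re, hf.2.re⟩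
  have him : IntervalIntegrable (fun t => (f t).im) volume a b := ⟨hf.1.im, hf.2.im⟩
  constructor
  · have h := (ac_ofReal (hre.absolutelyContinuousOnInterval_intervalIntegral hc)).fun_add
      ((ac_ofReal (him.absolutelyContinuousOnInterval_intervalIntegral hc)).const_smul Complex.I)
    -- The splitting into real and imaginary parts is available only on `[a, b]`, so the variation
    -- sums are compared instead of rewriting the function.
    refine squeeze_zero' (Eventually.of_forall fun E => Finset.sum_nonneg fun i _ => dist_nonneg)
      ?_ h
    rw [eventually_inf_principal]
    refine Eventually.of_forall fun E hE => Finset.sum_le_sum fun i hi => le_of_eq ?_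
    have key : ∀ x ∈ uIcc a b, ∫ t in c..x, f t = ((∫ t in c..x, (f t).re : ℝ) : ℂ)
        + Complex.I • ((∫ t in c..x, (f t).im : ℝ) : ℂ) := by
      intro x hx
      have hcx : IntervalIntegrable f volume c x := hf.mono_set (uIcc_subset_uIcc hc hx)
      have e1 := Complex.reCLM.intervalIntegral_comp_comm hcx
      have e2 := Complex.imCLM.intervalIntegral_comp_comm hcx
      simp only [Complex.reCLM_apply, Complex.imCLM_apply] at e1 e2
      rw [e1, e2, smul_eq_mul, mul_comm, Complex.re_add_im]
    beta_reduce
    rw [key _ (hE.1 i hi).1, key _ (hE.1 i hi).2]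
  · filter_upwards [hf.ae_hasDerivAt_integral] with x hx hx' using hx hx' c hc

theorem continuousOn (hu : HasACDeriv u u' a b) : ContinuousOn u (uIcc a b) :=
  hu.ac.continuousOn

theorem intervalIntegrable (hu : HasACDeriv u u' a b) : IntervalIntegrable u' volume a b :=
  intervalIntegrable_of_ac hu

theorem eqOn_left_of_deriv_eq_zero (hu : HasACDeriv u u' a b)
    (h : ∀ᵐ x : ℝ, x ∈ uIcc a b → u' x = 0) : ∀ x ∈ uIcc a b, u x = u a := by
  obtain ⟨C, hC⟩ := hu.ac.const_of_ae_hasDerivAt_zero (by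
    filter_upwards [hu.deriv, h] with x h1 h2 hx
    have := h1 hx
    rwa [h2 hx] at this)
  intro x hx
  rw [hC x hx, hC a left_mem_uIcc]

theorem eq_add_integral (hu : HasACDeriv u u' a b) : ∀ x ∈ uIcc a b,
    u x = u a + ∫ t in a..x, u' t := by
  intro x hx
  have h := (hu.sub (HasACDeriv.intervalIntegral hu.intervalIntegrable
    left_mem_uIcc)).eqOn_left_of_deriv_eq_zero (by simp) x hx
  simp only [intervalIntegral.integral_same, sub_zero] at h
  rw [← h]
  ring

end HasACDeriv

end DiracSystem

/-! ### Comparison of an oscillating function with a cosine. -/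

namespace DiracSystem

open Set Filter Topology ComplexConjugate

/-- A function that decreases from `1` to `-1` at least as fast as `cos (T x)` does so over a
length of at most `π / T`, and over exactly this length only if its slope is that of a cosine. -/
theorem arccos_comparison {f f' : ℝ → ℝ} {T u v : ℝ} (huv : u < v)
    (hd : ∀ x, HasDerivAt f (f' x) x) (hu : f u = 1) (hv : f v = -1)
    (hlt : ∀ x ∈ Ioo u v, |f x| < 1)
    (hle : ∀ x ∈ Ioo u v, f' x ≤ -(T * √(1 - f x ^ 2))) :
    T * (v - u) ≤ Real.pi ∧ (Real.pi ≤ T * (v - u) →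
      ∃ x ∈ Ioo u v, f' x = -(T * √(1 - f x ^ 2))) := by
  -- The slope bound makes `G` nondecreasing, and its total increase is `π - T (v - u)`. If this is
  -- not positive, `G` is constant and the slope bound is an equality.
  set G : ℝ → ℝ := fun x => Real.arccos (f x) - T * x with hG
  have hfc : Continuous f := continuous_iff_continuousAt.2 fun x => (hd x).continuousAt
  have hGc : ContinuousOn G (Icc u v) :=
    ((Real.continuous_arccos.comp hfc).sub (continuous_const.mul continuous_id)).continuousOn
  have hs : ∀ x ∈ Ioo u v, 0 < √(1 - f x ^ 2) := fun x hx => by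
    have := hlt x hx
    rw [← sq_lt_one_iff_abs_lt_one] at this
    exact Real.sqrt_pos.2 (by linarith)
  have hGd : ∀ x ∈ Ioo u v, HasDerivAt G (-(1 / √(1 - f x ^ 2)) * f' x - T * 1) x := by
    intro x hx
    have h := abs_lt.1 (hlt x hx)
    exact ((Real.hasDerivAt_arccos h.1.ne' h.2.ne).comp x (hd x)).sub
      ((hasDerivAt_id x).const_mul T)
  have hmono : MonotoneOn G (Icc u v) := by
    refine monotoneOn_of_deriv_nonneg (convex_Icc u v) hGc ?_ ?_
    · rw [interior_Icc]
      exact fun x hx => (hGd x hx).differentiableAt.differentiableWithinAt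
    · rw [interior_Icc]
      intro x hx
      rw [(hGd x hx).deriv]
      have h1 := hs x hx
      have h2 := hle x hx
      have : T ≤ (-f' x) / √(1 - f x ^ 2) := by
        rw [le_div_iff₀ h1]
        linarith
      have e : -(1 / √(1 - f x ^ 2)) * f' x = (-f' x) / √(1 - f x ^ 2) := by ring
      rw [e]
      linarith
  have hGu : G u = -(T * u) := by simp [hG, hu]
  have hGv : G v = Real.pi - T * v := by simp [hG, hv]
  have hle' := hmono (left_mem_Icc.2 huv.le) (right_mem_Icc.2 huv.le) huv.le
  rw [hGu, hGv] at hle'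
  refine ⟨by linarith, fun hge => ?_⟩
  have hconst : ∀ x ∈ Icc u v, G x = -(T * u) := by
    intro x hx
    have h1 := hmono (left_mem_Icc.2 huv.le) hx hx.1
    have h2 := hmono hx (right_mem_Icc.2 huv.le) hx.2
    rw [hGu] at h1
    rw [hGv] at h2
    linarith
  obtain ⟨x, hx⟩ := nonempty_Ioo.2 huv
  refine ⟨x, hx, ?_⟩
  have h0 : HasDerivAt G 0 x := by
    refine (hasDerivAt_const x (-(T * u))).congr_of_eventuallyEq ?_
    filter_upwards [Ioo_mem_nhds hx.1 hx.2] with y hy using hconst y (Ioo_subset_Icc_self hy)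
  have h1 := (hGd x hx).unique h0
  have h2 := (hs x hx).ne'
  field_simp at h1
  linarith

/-- If the oscillating function `f = R cos ψ` is bounded by `1`, moves at least as fast as a cosine
of frequency `T` and its phase `ψ` is asymptotic to `T x - c` at both ends, then it moves exactly
as fast as a cosine at some point. -/
theorem exists_deriv_eq_of_phase_asymptotic {f f' R ψ : ℝ → ℝ} {T c : ℝ} (hT : 0 < T)
    (hd : ∀ x, HasDerivAt f (f' x) x) (hf : ∀ x, |f x| ≤ 1)
    (hψm : StrictMono ψ) (hψc : Continuous ψ)
    (htop : Tendsto (fun x => ψ x - (T * x - c)) atTop (𝓝 0))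
    (hbot : Tendsto (fun x => ψ x - (T * x - c)) atBot (𝓝 0))
    (hR : ∀ x, 1 ≤ R x) (hfR : ∀ x, f x = R x * Real.cos (ψ x))
    (hneg : ∀ x, Real.sin (ψ x) < 0 → T * √(1 - f x ^ 2) ≤ f' x ∧ 0 < f' x)
    (hpos : ∀ x, 0 < Real.sin (ψ x) → f' x ≤ -(T * √(1 - f x ^ 2)) ∧ f' x < 0) :
    ∃ x, 0 < Real.sin (ψ x) ∧ |f x| < 1 ∧ f' x = -(T * √(1 - f x ^ 2)) := by
  have hlin : Tendsto (fun x : ℝ => T * x - c) atTop atTop :=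
    tendsto_atTop_add_const_right _ _ (tendsto_id.const_mul_atTop hT)
  have hlin' : Tendsto (fun x : ℝ => T * x - c) atBot atBot :=
    tendsto_atBot_add_const_right _ _ (tendsto_id.const_mul_atBot hT)
  have hψtop : Tendsto ψ atTop atTop := by
    simpa using htop.add_atTop hlin
  have hψbot : Tendsto ψ atBot atBot := by
    simpa using hbot.add_atBot hlin'
  let e : ℝ ≃o ℝ := hψm.orderIsoOfSurjective ψ (hψc.surjective hψtop hψbot)
  have he : ∀ y, ψ (e.symm y) = y := fun y => e.apply_symm_apply y
  -- These are the points where `cos ψ = ±1`; since `R ≥ 1` and `|f| ≤ 1`, there `f = ±1` as well.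
  set l : ℤ → ℝ := fun k => e.symm (k * Real.pi) with hl
  have hψl : ∀ k, ψ (l k) = k * Real.pi := fun k => he _
  have hllt : ∀ k, l k < l (k + 1) := fun k => by
    refine e.symm.strictMono ?_
    push_cast
    linarith [Real.pi_pos]
  -- A value `±1` would be an extremum of `f`, whereas `f'` does not vanish off the zeros of `sin
  -- ψ`.
  have habs : ∀ x, Real.sin (ψ x) ≠ 0 → |f x| < 1 := by
    intro x hx
    refine lt_of_le_of_ne (hf x) fun h => ?_
    have hne : f' x ≠ 0 := by
      rcases lt_or_gt_of_ne hx with h | h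
      · exact (hneg x h).2.ne'
      · exact (hpos x h).2.ne
    rcases eq_or_eq_neg_of_abs_eq h with h | h
    · refine hne (IsLocalMax.hasDerivAt_eq_zero (Eventually.of_forall fun y => ?_) (hd x))
      rw [h]
      exact (abs_le.1 (hf y)).2
    · refine hne (IsLocalMin.hasDerivAt_eq_zero (Eventually.of_forall fun y => ?_) (hd x))
      rw [h]
      exact (abs_le.1 (hf y)).1
  have hfl : ∀ k, f (l k) = Real.cos (k * Real.pi) := by
    intro k
    have h1 := hfR (l k)
    rw [hψl, Real.cos_int_mul_pi] at h1
    have h2 : |f (l k)| = R (l k) := by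
      rw [h1, abs_mul, abs_of_nonneg (by linarith [hR (l k)])]
      simp
    have h3 : R (l k) = 1 := le_antisymm (h2 ▸ hf _) (hR _)
    rw [h1, h3, one_mul, Real.cos_int_mul_pi]
  have hstep : ∀ k : ℤ, T * (l (k + 1) - l k) ≤ Real.pi ∧ (Real.pi ≤ T * (l (k + 1) - l k) →
      ∃ x ∈ Ioo (l k) (l (k + 1)), Real.cos (k * Real.pi) * f' x
        = -(T * √(1 - (Real.cos (k * Real.pi) * f x) ^ 2))) := by
    intro k
    -- The sign normalizes `f` so that it falls from `1` to `-1` between consecutive points `l k`.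
    set σ := Real.cos (k * Real.pi) with hσ
    have hσ2 : σ = 1 ∨ σ = -1 := by
      rw [hσ, Real.cos_int_mul_pi]
      rcases Int.even_or_odd k with h | h
      · left
        exact h.neg_one_zpow
      · right
        exact h.neg_one_zpow
    have hsq : ∀ x, (σ * f x) ^ 2 = f x ^ 2 := fun x => by
      rcases hσ2 with h | h <;> rw [h] <;> ring
    have hsin : ∀ x ∈ Ioo (l k) (l (k + 1)), 0 < σ * Real.sin (ψ x) := by
      intro x hx
      have h1 := hψm hx.1
      have h2 := hψm hx.2
      rw [hψl] at h1 h2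
      push_cast at h2
      have h3 : 0 < Real.sin (ψ x - k * Real.pi) :=
        Real.sin_pos_of_pos_of_lt_pi (by linarith) (by linarith)
      rw [Real.sin_sub, Real.sin_int_mul_pi] at h3
      linarith
    refine arccos_comparison (f := fun x => σ * f x) (hllt k) (fun x => (hd x).const_mul σ)
      ?_ ?_ ?_ ?_
    · rw [hfl, ← hσ]
      rcases hσ2 with h | h <;> rw [h] <;> norm_num
    · rw [hfl]
      push_cast
      rw [add_mul, one_mul, Real.cos_add_pi, ← hσ]
      rcases hσ2 with h | h <;> rw [h] <;> norm_num
    · intro x hx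
      have h := habs x (fun h0 => by have := hsin x hx; rw [h0] at this; simp at this)
      rcases hσ2 with h' | h' <;> simpa [h'] using h
    · intro x hx
      have h := hsin x hx
      rw [hsq]
      rcases hσ2 with h' | h' <;> rw [h'] at h ⊢
      · have := (hpos x (by linarith)).1
        linarith
      · have := (hneg x (by linarith)).1
        linarith
  have hd_anti : Antitone fun k : ℤ => T * l k - k * Real.pi := by
    refine antitone_int_of_succ_le fun k => ?_
    have := (hstep k).1
    push_cast
    linarith
  have hlim : ∀ F : Filter ℝ, ∀ G : Filter ℤ, Tendsto (fun x => ψ x - (T * x - c)) F (𝓝 0) →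
      Tendsto l G F → Tendsto (fun k : ℤ => T * l k - k * Real.pi) G (𝓝 c) := by
    intro F G h1 h2
    have h3 := (h1.comp h2).const_sub c
    simp only [Function.comp_def, hψl, sub_zero] at h3
    refine h3.congr fun k => ?_
    ring
  have hltop : Tendsto l atTop atTop := by
    refine e.symm.tendsto_atTop.comp ?_
    exact tendsto_intCast_atTop_atTop.atTop_mul_const Real.pi_pos
  have hlbot : Tendsto l atBot atBot := by
    refine e.symm.tendsto_atBot.comp ?_
    exact (tendsto_intCast_atBot_iff.2 tendsto_id).atBot_mul_const Real.pi_pos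
  -- An antitone sequence with the same limit `c` at both ends is constant. Only `T * l 0 ≤ c ≤ T *
  -- l 1 - π` is used.
  have h1 := hd_anti.le_of_tendsto (hlim _ _ htop hltop) 1
  have h0 := hd_anti.ge_of_tendsto (hlim _ _ hbot hlbot) 0
  simp only [Int.cast_one, one_mul, Int.cast_zero, zero_mul, sub_zero] at h0 h1
  obtain ⟨x, hx, hx'⟩ := (hstep 0).2 (by rw [zero_add]; linarith)
  simp only [Int.cast_zero, zero_mul, Real.cos_zero, one_mul] at hx'
  have hsx : 0 < Real.sin (ψ x) := by
    have h1 := hψm hx.1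
    have h2 := hψm hx.2
    rw [hψl] at h1 h2
    refine Real.sin_pos_of_pos_of_lt_pi ?_ ?_
    · simpa using h1
    · simpa using h2
  exact ⟨x, hsx, habs x hsx.ne', hx'⟩

end DiracSystem

/-! ### The reduced system: conservation law, logarithm, change of spectral parameter. -/

namespace DiracSystem

open Set Filter Topology ComplexConjugate

/-- The unimodular function `exp (i μ x)`. -/
noncomputable def phase (μ x : ℝ) : ℂ := Complex.exp ((μ * x : ℝ) * Complex.I)

theorem norm_phase (μ x : ℝ) : ‖phase μ x‖ = 1 := Complex.norm_exp_ofReal_mul_I _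

theorem phase_mul_conj (μ x : ℝ) : phase μ x * conj (phase μ x) = 1 := by
  rw [Complex.mul_conj, Complex.normSq_eq_norm_sq, norm_phase]
  simp

theorem phase_add (μ ν x : ℝ) : phase (μ + ν) x = phase μ x * phase ν x := by
  rw [phase, phase, phase, ← Complex.exp_add]
  congr 1
  push_cast
  ring

@[simp]
theorem phase_zero_right (μ : ℝ) : phase μ 0 = 1 := by simp [phase]

theorem continuous_phase_left (x : ℝ) : Continuous fun μ => phase μ x := by
  unfold phase
  fun_prop

theorem continuous_phase (μ : ℝ) : Continuous fun x => phase μ x := by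
  unfold phase
  fun_prop

theorem hasACDeriv_phase (μ a b : ℝ) :
    HasACDeriv (phase μ) (fun x => phase μ x * (μ * Complex.I)) a b := by
  refine HasACDeriv.of_hasDerivAt (fun x => ?_) ((continuous_phase μ).mul continuous_const)
  have h := (((hasDerivAt_id x).const_mul μ).ofReal_comp.mul_const Complex.I).cexp
  simp only [mul_one] at h
  exact h

/-- The Dirac system in the gauge in which its diagonal part is removed. -/
structure IsReducedSolution (g : ℝ → ℂ) (T lam : ℝ) (a b : ℝ → ℂ) : Prop where
  left : HasACDeriv a (fun x => g x * phase (2 * lam) x * b x) 0 T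
  right : HasACDeriv b (fun x => conj (g x * phase (2 * lam) x) * a x) 0 T
  left_zero : a 0 = 1
  right_zero : b 0 = 0

namespace IsReducedSolution

variable {g : ℝ → ℂ} {T lam : ℝ} {a b : ℝ → ℂ}

/-- The coefficient matrix lies in `su(1,1)`, so the indefinite form is conserved. -/
theorem mul_conj_sub (h : IsReducedSolution g T lam a b) {x : ℝ} (hx : x ∈ uIcc 0 T) :
    a x * conj (a x) - b x * conj (b x) = 1 := by
  have h1 := (h.left.mul h.left.conjugate).sub (h.right.mul h.right.conjugate)
  rw [h1.eqOn_left_of_deriv_eq_zero (Eventually.of_forall fun y _ => ?_) x hx]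
  · simp [h.left_zero, h.right_zero]
  · simp only [map_mul, Complex.conj_conj]
    ring

theorem norm_sq_sub (h : IsReducedSolution g T lam a b) {x : ℝ} (hx : x ∈ uIcc 0 T) :
    ‖a x‖ ^ 2 - ‖b x‖ ^ 2 = 1 := by
  have h1 := h.mul_conj_sub hx
  rw [Complex.mul_conj, Complex.mul_conj, Complex.normSq_eq_norm_sq,
    Complex.normSq_eq_norm_sq] at h1
  exact_mod_cast h1

theorem one_le_norm (h : IsReducedSolution g T lam a b) {x : ℝ} (hx : x ∈ uIcc 0 T) :
    1 ≤ ‖a x‖ := by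
  have h1 := h.norm_sq_sub hx
  nlinarith [sq_nonneg ‖b x‖, norm_nonneg (a x)]

theorem ne_zero (h : IsReducedSolution g T lam a b) {x : ℝ} (hx : x ∈ uIcc 0 T) : a x ≠ 0 := by
  have h1 := h.one_le_norm hx
  intro h0
  rw [h0, norm_zero] at h1
  linarith

theorem norm_lt_norm (h : IsReducedSolution g T lam a b) {x : ℝ} (hx : x ∈ uIcc 0 T) :
    ‖b x‖ < ‖a x‖ := by
  have h1 := h.norm_sq_sub hx
  refine lt_of_pow_lt_pow_left₀ 2 (norm_nonneg _) ?_
  linarith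

theorem norm_div_le_one (h : IsReducedSolution g T lam a b) {x : ℝ} (hx : x ∈ uIcc 0 T) :
    ‖b x / a x‖ ≤ 1 := by
  rw [norm_div]
  exact div_le_one_of_le₀ (h.norm_lt_norm hx).le (norm_nonneg _)

theorem continuousOn_div (h : IsReducedSolution g T lam a b) :
    ContinuousOn (fun x => b x / a x) (uIcc 0 T) :=
  h.right.continuousOn.div h.left.continuousOn fun _ hx => h.ne_zero hx

/-- The logarithm of the first component of a solution. -/
noncomputable def logLeft (g : ℝ → ℂ) (lam : ℝ) (a b : ℝ → ℂ) (x : ℝ) : ℂ :=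
  ∫ t in (0 : ℝ)..x, g t * phase (2 * lam) t * (b t / a t)

theorem intervalIntegrable_logDeriv (h : IsReducedSolution g T lam a b)
    (hg : IntervalIntegrable g volume 0 T) :
    IntervalIntegrable (fun t => g t * phase (2 * lam) t * (b t / a t)) volume 0 T :=
  (hg.mul_continuousOn (continuous_phase _).continuousOn).mul_continuousOn h.continuousOn_div

theorem hasACDeriv_logLeft (h : IsReducedSolution g T lam a b)
    (hg : IntervalIntegrable g volume 0 T) :
    HasACDeriv (logLeft g lam a b) (fun t => g t * phase (2 * lam) t * (b t / a t)) 0 T :=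
  HasACDeriv.intervalIntegral (h.intervalIntegrable_logDeriv hg) left_mem_uIcc

theorem norm_logDeriv_le (h : IsReducedSolution g T lam a b) {x : ℝ} (hx : x ∈ uIcc 0 T) :
    ‖g x * phase (2 * lam) x * (b x / a x)‖ ≤ ‖g x‖ := by
  rw [norm_mul, norm_mul, norm_phase, mul_one]
  exact mul_le_of_le_one_right (norm_nonneg _) (h.norm_div_le_one hx)

theorem mul_exp_neg_logLeft (h : IsReducedSolution g T lam a b)
    (hg : IntervalIntegrable g volume 0 T) {x : ℝ} (hx : x ∈ uIcc 0 T) :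
    a x * Complex.exp (-logLeft g lam a b x) = 1 := by
  have h1 := h.left.mul ((h.hasACDeriv_logLeft hg).const_mul (-1)).cexp
  have h2 := h1.eqOn_left_of_deriv_eq_zero (Eventually.of_forall fun y hy => ?_) x hx
  · simpa [h.left_zero, logLeft] using h2
  · have := h.ne_zero hy
    field_simp
    ring

/-- The integrand of `logLeft` is `a' / a`. The integral thus selects a branch of `log a` without
reference to the principal logarithm. -/
theorem exp_logLeft (h : IsReducedSolution g T lam a b)
    (hg : IntervalIntegrable g volume 0 T) {x : ℝ} (hx : x ∈ uIcc 0 T) :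
    Complex.exp (logLeft g lam a b x) = a x := by
  have h1 := h.mul_exp_neg_logLeft hg hx
  rw [Complex.exp_neg] at h1
  have h2 := Complex.exp_ne_zero (logLeft g lam a b x)
  field_simp at h1
  exact h1.symm

/-- Since `|b / a| ≤ 1`, the logarithmic derivative of `a` is at most `|g|`. The point is that the
bound does not depend on `lam`. -/
theorem norm_left_le (h : IsReducedSolution g T lam a b) (hT : 0 ≤ T)
    (hg : IntervalIntegrable g volume 0 T) {x : ℝ} (hx : x ∈ Icc 0 T) :
    ‖a x‖ ≤ Real.exp (∫ t in (0 : ℝ)..T, ‖g t‖) := by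
  have hx' : x ∈ uIcc 0 T := by rwa [uIcc_of_le hT]
  rw [← h.exp_logLeft hg hx', Complex.norm_exp]
  refine Real.exp_le_exp.2 ((Complex.re_le_norm _).trans ?_)
  have hsub : uIcc 0 x ⊆ uIcc 0 T := uIcc_subset_uIcc left_mem_uIcc hx'
  calc ‖logLeft g lam a b x‖
      ≤ ∫ t in (0 : ℝ)..x, ‖g t * phase (2 * lam) t * (b t / a t)‖ :=
        intervalIntegral.norm_integral_le_integral_norm hx.1
    _ ≤ ∫ t in (0 : ℝ)..x, ‖g t‖ := by
        refine intervalIntegral.integral_mono_on hx.1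
          ((h.intervalIntegrable_logDeriv hg).norm.mono_set hsub) (hg.norm.mono_set hsub)
          fun t ht => h.norm_logDeriv_le (hsub ?_)
        rwa [uIcc_of_le hx.1]
    _ ≤ ∫ t in (0 : ℝ)..T, ‖g t‖ := by
        refine intervalIntegral.integral_mono_interval le_rfl hx.1 hx.2
          (Eventually.of_forall fun t => norm_nonneg _) hg.norm

section comparison

variable {lam₀ : ℝ} {a₀ b₀ : ℝ → ℂ}

/-- The first entry of the transfer matrix between two spectral parameters. -/
noncomputable def transferLeft (δ : ℝ) (a₀ b₀ a b : ℝ → ℂ) (x : ℝ) : ℂ :=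
  conj (a₀ x) * (conj (phase δ x) * a x) - conj (b₀ x) * (phase δ x * b x)

/-- The second entry of the transfer matrix between two spectral parameters. -/
noncomputable def transferRight (δ : ℝ) (a₀ b₀ a b : ℝ → ℂ) (x : ℝ) : ℂ :=
  a₀ x * (phase δ x * b x) - b₀ x * (conj (phase δ x) * a x)

theorem phase_two_mul (lam lam₀ x : ℝ) : phase (2 * lam) x
    = phase (2 * lam₀) x * phase (lam - lam₀) x * phase (lam - lam₀) x := by
  rw [← phase_add, ← phase_add]
  congr 1
  ring

/-- Variation of constants. With `δ = lam - lam₀`, the pair `(e^{-iδx} a, e^{iδx} b)` solves the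
system at `lam₀` up to the diagonal term `diag (-iδ, iδ)`. Applying the inverse fundamental matrix
at `lam₀` cancels every term with `g`. -/
theorem transferLeft_eq (h₀ : IsReducedSolution g T lam₀ a₀ b₀)
    (h : IsReducedSolution g T lam a b) {x : ℝ} (hx : x ∈ uIcc 0 T) :
    transferLeft (lam - lam₀) a₀ b₀ a b x = 1 - Complex.I * (lam - lam₀) *
      ∫ t in (0 : ℝ)..x, (conj (a₀ t) * (conj (phase (lam - lam₀) t) * a t)
        + conj (b₀ t) * (phase (lam - lam₀) t * b t)) := by
  have hp := hasACDeriv_phase (lam - lam₀) 0 T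
  have h1 := (h₀.left.conjugate.mul (hp.conjugate.mul h.left)).sub
    (h₀.right.conjugate.mul (hp.mul h.right))
  have h2 := (h1.congr_deriv (v' := fun t => (-(Complex.I * (lam - lam₀))) *
    (conj (a₀ t) * (conj (phase (lam - lam₀) t) * a t)
        + conj (b₀ t) * (phase (lam - lam₀) t * b t)))
    (Eventually.of_forall fun t _ => ?_)).eq_add_integral x hx
  · unfold transferLeft
    rw [h2, intervalIntegral.integral_const_mul]
    simp only [h₀.left_zero, h₀.right_zero, h.left_zero, h.right_zero, phase_zero_right, map_one,
      map_zero]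
    ring
  · have e := phase_mul_conj (lam - lam₀) t
    simp only [phase_two_mul lam lam₀ t, map_mul, Complex.conj_conj, Complex.conj_I,
      Complex.conj_ofReal, Complex.ofReal_sub, map_sub]
    linear_combination (conj (a₀ t) * g t * phase (2 * lam₀) t * phase (lam - lam₀) t * b t
      - conj (b₀ t) * conj (g t) * conj (phase (2 * lam₀) t) * conj (phase (lam - lam₀) t)
        * a t) * e

theorem transferRight_eq (h₀ : IsReducedSolution g T lam₀ a₀ b₀)
    (h : IsReducedSolution g T lam a b) {x : ℝ} (hx : x ∈ uIcc 0 T) :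
    transferRight (lam - lam₀) a₀ b₀ a b x = Complex.I * (lam - lam₀) *
      ∫ t in (0 : ℝ)..x, (b₀ t * (conj (phase (lam - lam₀) t) * a t)
        + a₀ t * (phase (lam - lam₀) t * b t)) := by
  have hp := hasACDeriv_phase (lam - lam₀) 0 T
  have h1 := (h₀.left.mul (hp.mul h.right)).sub (h₀.right.mul (hp.conjugate.mul h.left))
  have h2 := (h1.congr_deriv (v' := fun t => (Complex.I * (lam - lam₀)) *
    (b₀ t * (conj (phase (lam - lam₀) t) * a t) + a₀ t * (phase (lam - lam₀) t * b t)))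
    (Eventually.of_forall fun t _ => ?_)).eq_add_integral x hx
  · unfold transferRight
    rw [h2, intervalIntegral.integral_const_mul]
    simp only [h₀.left_zero, h₀.right_zero, h.left_zero, h.right_zero, phase_zero_right, map_one]
    ring
  · have e := phase_mul_conj (lam - lam₀) t
    simp only [phase_two_mul lam lam₀ t, map_mul, Complex.conj_I,
      Complex.conj_ofReal, Complex.ofReal_sub, map_sub]
    linear_combination (a₀ t * conj (g t) * conj (phase (2 * lam₀) t)
      * conj (phase (lam - lam₀) t) * a t
      - b₀ t * g t * phase (2 * lam₀) t * phase (lam - lam₀) t * b t) * e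

/-- Inverts the definition of the transfer entries: the fundamental matrix with columns `(a₀, b₀)`
and `(conj b₀, conj a₀)` has determinant one. -/
theorem conj_phase_mul_left (h₀ : IsReducedSolution g T lam₀ a₀ b₀) (δ : ℝ) (a b : ℝ → ℂ)
    {x : ℝ} (hx : x ∈ uIcc 0 T) : conj (phase δ x) * a x
      = a₀ x * transferLeft δ a₀ b₀ a b x + conj (b₀ x) * transferRight δ a₀ b₀ a b x := by
  have h1 := h₀.mul_conj_sub hx
  unfold transferLeft transferRight
  linear_combination (-(conj (phase δ x) * a x)) * h1

theorem phase_mul_right (h₀ : IsReducedSolution g T lam₀ a₀ b₀) (δ : ℝ) (a b : ℝ → ℂ)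
    {x : ℝ} (hx : x ∈ uIcc 0 T) : phase δ x * b x
      = b₀ x * transferLeft δ a₀ b₀ a b x + conj (a₀ x) * transferRight δ a₀ b₀ a b x := by
  have h1 := h₀.mul_conj_sub hx
  unfold transferLeft transferRight
  linear_combination (-(phase δ x * b x)) * h1

end comparison

end IsReducedSolution

end DiracSystem

/-! ### Dependence on the spectral parameter: asymptotics, continuity, derivative. -/

namespace DiracSystem

open Set Filter Topology ComplexConjugate

/-- The other factor vanishes at `x₀`, so continuity of `N` suffices. This permits differentiation
in the spectral parameter without differentiating under an integral. -/
theorem hasDerivAt_sub_mul_of_continuousAt {N : ℝ → ℂ} {x₀ : ℝ} (hN : ContinuousAt N x₀) :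
    HasDerivAt (fun x : ℝ => ((x : ℂ) - x₀) * N x) (N x₀) x₀ := by
  rw [hasDerivAt_iff_tendsto_slope]
  refine (hN.tendsto.mono_left nhdsWithin_le_nhds).congr' ?_
  filter_upwards [self_mem_nhdsWithin] with x hx
  have h : ((x : ℂ) - x₀) ≠ 0 := by
    rw [sub_ne_zero]
    exact_mod_cast hx
  rw [slope_def_module, sub_self, zero_mul, sub_zero, Complex.real_smul]
  push_cast
  field_simp

theorem tendsto_integral_mul_phase {g : ℝ → ℂ} {T : ℝ} (hT : 0 ≤ T) :
    Tendsto (fun lam => ∫ t in (0 : ℝ)..T, g t * phase (2 * lam) t) (cocompact ℝ) (𝓝 0) := by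
  have h1 := Real.tendsto_integral_exp_smul_cocompact (indicator (Ioc 0 T) g)
  -- The Fourier kernel is `exp (-2πi v w)`, so `w = -lam / π` gives `exp (2i lam v)`.
  have h2 : Tendsto (fun lam : ℝ => lam * (-Real.pi⁻¹)) (cocompact ℝ) (cocompact ℝ) :=
    (Homeomorph.mulRight₀ (-Real.pi⁻¹) (by simp [Real.pi_ne_zero])).isClosedEmbedding.tendsto_cocompact
  refine (h1.comp h2).congr fun lam => ?_
  rw [Function.comp_apply, intervalIntegral.integral_of_le hT,
    ← integral_indicator measurableSet_Ioc]
  congr 1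
  ext v
  by_cases hv : v ∈ Ioc 0 T
  · rw [indicator_of_mem hv, indicator_of_mem hv, Circle.smul_def, Real.fourierChar_apply,
      smul_eq_mul, mul_comm, phase]
    congr 2
    have := Real.pi_ne_zero
    congr 2
    field_simp
  · rw [indicator_of_notMem hv, indicator_of_notMem hv, smul_zero]

namespace IsReducedSolution

variable {g : ℝ → ℂ} {T : ℝ}

theorem norm_right_le {lam : ℝ} {a b : ℝ → ℂ} (h : IsReducedSolution g T lam a b) (hT : 0 ≤ T)
    (hg : IntervalIntegrable g volume 0 T) {x : ℝ} (hx : x ∈ Icc 0 T) :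
    ‖b x‖ ≤ Real.exp (∫ t in (0 : ℝ)..T, ‖g t‖) :=
  (h.norm_lt_norm (by rwa [uIcc_of_le hT])).le.trans (h.norm_left_le hT hg hx)

/-- Riemann–Lebesgue does not apply directly, because `b / a` depends on `lam`. Integration by parts
moves the oscillation into the primitive of `g e^{2i lam t}`, and the derivative of `w = b / a` is
given by the Riccati equation `w' = conj G - G w²` with `G = g e^{2i lam x}`. -/
theorem logLeft_eq {lam : ℝ} {a b : ℝ → ℂ} (h : IsReducedSolution g T lam a b)
    (hg : IntervalIntegrable g volume 0 T) :
    logLeft g lam a b T = (∫ t in (0 : ℝ)..T, g t * phase (2 * lam) t) * (b T / a T)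
      - ∫ x in (0 : ℝ)..T, (∫ t in (0 : ℝ)..x, g t * phase (2 * lam) t) *
        (conj (g x * phase (2 * lam) x) - g x * phase (2 * lam) x * (b x / a x) ^ 2) := by
  have hG : IntervalIntegrable (fun t => g t * phase (2 * lam) t) volume 0 T :=
    hg.mul_continuousOn (continuous_phase _).continuousOn
  have hF := HasACDeriv.intervalIntegral hG left_mem_uIcc
  have hinv : ∀ x ∈ uIcc 0 T, Complex.exp (-1 * logLeft g lam a b x) = (a x)⁻¹ := fun x hx => by
    rw [neg_one_mul, Complex.exp_neg, h.exp_logLeft hg hx]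
  -- The quotient `b / a` is written as `b exp (-log a)`, so that the product and exponential rules
  -- apply.
  have hw := h.right.mul ((h.hasACDeriv_logLeft hg).const_mul (-1)).cexp
  have hw' := hw.congr_deriv (v' := fun x => conj (g x * phase (2 * lam) x)
      - g x * phase (2 * lam) x * (b x / a x) ^ 2) (Eventually.of_forall fun x hx => by
    have := h.ne_zero hx
    simp only [hinv x hx]
    field_simp
    ring)
  have hFw := hF.mul hw'
  have h1 := hFw.eq_add_integral T right_mem_uIcc
  simp only [intervalIntegral.integral_same, zero_mul, zero_add] at h1
  rw [intervalIntegral.integral_add (hG.mul_continuousOn hw.continuousOn)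
    (hw'.intervalIntegrable.continuousOn_mul hF.continuousOn), hinv T right_mem_uIcc,
    ← div_eq_mul_inv] at h1
  rw [h1, logLeft, add_sub_cancel_right]
  refine intervalIntegral.integral_congr fun x hx => ?_
  simp only [hinv x hx, div_eq_mul_inv]

theorem norm_logLeft_le {lam : ℝ} {a b : ℝ → ℂ} (h : IsReducedSolution g T lam a b) (hT : 0 ≤ T)
    (hg : IntervalIntegrable g volume 0 T) :
    ‖logLeft g lam a b T‖ ≤ ‖∫ t in (0 : ℝ)..T, g t * phase (2 * lam) t‖
      + ∫ x in (0 : ℝ)..T, ‖∫ t in (0 : ℝ)..x, g t * phase (2 * lam) t‖ * (2 * ‖g x‖) := by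
  rw [h.logLeft_eq hg]
  refine (norm_sub_le _ _).trans (add_le_add ?_ ?_)
  · rw [norm_mul]
    exact mul_le_of_le_one_right (norm_nonneg _) (h.norm_div_le_one right_mem_uIcc)
  · have hG : IntervalIntegrable (fun t => g t * phase (2 * lam) t) volume 0 T :=
      hg.mul_continuousOn (continuous_phase _).continuousOn
    have hF := HasACDeriv.intervalIntegral hG left_mem_uIcc
    refine intervalIntegral.norm_integral_le_of_norm_le hT (Eventually.of_forall fun x hx => ?_)
      ((hg.norm.const_mul 2).continuousOn_mul hF.continuousOn.norm)
    rw [norm_mul]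
    refine mul_le_mul_of_nonneg_left ?_ (norm_nonneg _)
    have h1 := h.norm_div_le_one (x := x) (by
      rw [uIcc_of_le hT]
      exact Ioc_subset_Icc_self hx)
    have h2 : ‖b x / a x‖ ^ 2 ≤ 1 := pow_le_one₀ (norm_nonneg _) h1
    refine (norm_sub_le _ _).trans ?_
    rw [RCLike.norm_conj, norm_mul, norm_mul, norm_mul, norm_phase, norm_pow, mul_one]
    nlinarith [norm_nonneg (g x)]

variable {a b : ℝ → ℝ → ℂ}

/-- The primitives tend to zero for each fixed `x` by Riemann–Lebesgue, and are bounded by the `L¹`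
norm of `g`; dominated convergence, which needs `l` countably generated, handles the remaining
integral. -/
theorem tendsto_logLeft (H : ∀ lam, IsReducedSolution g T lam (a lam) (b lam)) (hT : 0 ≤ T)
    (hg : IntervalIntegrable g volume 0 T) {l : Filter ℝ} [l.IsCountablyGenerated]
    (hl : l ≤ cocompact ℝ) :
    Tendsto (fun lam => logLeft g lam (a lam) (b lam) T) l (𝓝 0) := by
  have hRL : ∀ x, 0 ≤ x → Tendsto (fun lam => ‖∫ t in (0 : ℝ)..x, g t * phase (2 * lam) t‖)
      l (𝓝 0) := fun x hx => by
    simpa using ((tendsto_integral_mul_phase (g := g) hx).mono_left hl).norm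
  have hG : ∀ lam : ℝ, IntervalIntegrable (fun t => g t * phase (2 * lam) t) volume 0 T :=
    fun lam => hg.mul_continuousOn (continuous_phase _).continuousOn
  have hdom : Tendsto (fun lam => ∫ x in (0 : ℝ)..T,
      ‖∫ t in (0 : ℝ)..x, g t * phase (2 * lam) t‖ * (2 * ‖g x‖)) l
      (𝓝 (∫ x in (0 : ℝ)..T, (0 : ℝ))) := by
    refine intervalIntegral.tendsto_integral_filter_of_dominated_convergence
      (fun x => (∫ t in (0 : ℝ)..T, ‖g t‖) * (2 * ‖g x‖)) (Eventually.of_forall fun lam => ?_)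
      (Eventually.of_forall fun lam => Eventually.of_forall fun x hx => ?_)
      ((hg.norm.const_mul 2).const_mul _) (Eventually.of_forall fun x hx => ?_)
    · have hF := HasACDeriv.intervalIntegral (hG lam) left_mem_uIcc
      exact ((hg.norm.const_mul 2).continuousOn_mul hF.continuousOn.norm).def'.aestronglyMeasurable
    · rw [uIoc_of_le hT] at hx
      rw [norm_mul, norm_norm, Real.norm_of_nonneg (by positivity : 0 ≤ 2 * ‖g x‖)]
      refine mul_le_mul_of_nonneg_right ?_ (by positivity)
      refine (intervalIntegral.norm_integral_le_integral_norm hx.1.le).trans ?_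
      simp only [norm_mul, norm_phase, mul_one]
      exact intervalIntegral.integral_mono_interval le_rfl hx.1.le hx.2
        (Eventually.of_forall fun t => norm_nonneg _) hg.norm
    · rw [uIoc_of_le hT] at hx
      simpa using (hRL x hx.1.le).mul_const (2 * ‖g x‖)
  rw [intervalIntegral.integral_zero] at hdom
  refine squeeze_zero_norm (fun lam => (H lam).norm_logLeft_le hT hg) ?_
  simpa using (hRL T hT).add hdom

section continuity

variable (lam₀ : ℝ)

theorem tendsto_phase_sub (x : ℝ) : Tendsto (fun lam => phase (lam - lam₀) x) (𝓝 lam₀) (𝓝 1) := by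
  have h : Continuous fun lam => phase (lam - lam₀) x :=
    (continuous_phase_left x).comp (continuous_id.sub continuous_const)
  have h1 := h.tendsto lam₀
  simpa [phase] using h1

theorem tendsto_of_integral_bound {N : ℝ → ℂ} {C : ℝ} (h : ∀ lam, ‖N lam‖ ≤ C) :
    Tendsto (fun lam : ℝ => Complex.I * ((lam : ℂ) - lam₀) * N lam) (𝓝 lam₀) (𝓝 0) := by
  have h1 : Tendsto (fun lam : ℝ => |lam - lam₀| * C) (𝓝 lam₀) (𝓝 0) := by
    have : Continuous fun lam : ℝ => |lam - lam₀| * C := by fun_prop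
    simpa using this.tendsto lam₀
  refine squeeze_zero_norm (fun lam => ?_) h1
  rw [norm_mul, norm_mul, Complex.norm_I, one_mul, ← Complex.ofReal_sub, Complex.norm_real,
    Real.norm_eq_abs]
  exact mul_le_mul_of_nonneg_left (h lam) (abs_nonneg _)

theorem norm_add_mul_le {p q r s ε η : ℂ} {M : ℝ} (hp : ‖p‖ ≤ M) (hq : ‖q‖ ≤ M) (hr : ‖r‖ ≤ M)
    (hs : ‖s‖ ≤ M) (hε : ‖ε‖ = 1) (hη : ‖η‖ = 1) :
    ‖p * (ε * q) + r * (η * s)‖ ≤ 2 * M ^ 2 := by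
  refine (norm_add_le _ _).trans ?_
  rw [norm_mul, norm_mul, norm_mul, norm_mul, hε, hη, one_mul, one_mul]
  have := mul_le_mul hp hq (norm_nonneg _) ((norm_nonneg _).trans hp)
  have := mul_le_mul hr hs (norm_nonneg _) ((norm_nonneg _).trans hr)
  linarith

variable {lam₀}

theorem tendsto_transferLeft (H : ∀ lam, IsReducedSolution g T lam (a lam) (b lam)) (hT : 0 ≤ T)
    (hg : IntervalIntegrable g volume 0 T) {x : ℝ} (hx : x ∈ Icc 0 T) :
    Tendsto (fun lam => transferLeft (lam - lam₀) (a lam₀) (b lam₀) (a lam) (b lam) x)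
      (𝓝 lam₀) (𝓝 1) := by
  have hx' : x ∈ uIcc 0 T := by rwa [uIcc_of_le hT]
  simp only [fun lam => transferLeft_eq (H lam₀) (H lam) hx']
  have h1 := (tendsto_of_integral_bound lam₀ (fun lam =>
    intervalIntegral.norm_integral_le_of_norm_le_const (a := 0) (b := x)
    (f := fun t => conj (a lam₀ t) * (conj (phase (lam - lam₀) t) * a lam t)
        + conj (b lam₀ t) * (phase (lam - lam₀) t * b lam t))
    (C := 2 * Real.exp (∫ t in (0 : ℝ)..T, ‖g t‖) ^ 2) fun t ht => ?_)).const_sub 1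
  · simpa using h1
  · rw [uIoc_of_le hx.1] at ht
    have ht' : t ∈ Icc 0 T := ⟨ht.1.le, ht.2.trans hx.2⟩
    refine norm_add_mul_le ?_ ((H lam).norm_left_le hT hg ht') ?_
      ((H lam).norm_right_le hT hg ht') ?_ (norm_phase _ _)
    · rw [RCLike.norm_conj]
      exact (H lam₀).norm_left_le hT hg ht'
    · rw [RCLike.norm_conj]
      exact (H lam₀).norm_right_le hT hg ht'
    · rw [RCLike.norm_conj, norm_phase]

theorem tendsto_transferRight (H : ∀ lam, IsReducedSolution g T lam (a lam) (b lam)) (hT : 0 ≤ T)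
    (hg : IntervalIntegrable g volume 0 T) {x : ℝ} (hx : x ∈ Icc 0 T) :
    Tendsto (fun lam => transferRight (lam - lam₀) (a lam₀) (b lam₀) (a lam) (b lam) x)
      (𝓝 lam₀) (𝓝 0) := by
  have hx' : x ∈ uIcc 0 T := by rwa [uIcc_of_le hT]
  simp only [fun lam => transferRight_eq (H lam₀) (H lam) hx']
  refine tendsto_of_integral_bound lam₀ (fun lam =>
    intervalIntegral.norm_integral_le_of_norm_le_const
    (C := 2 * Real.exp (∫ t in (0 : ℝ)..T, ‖g t‖) ^ 2) fun t ht => ?_)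
  rw [uIoc_of_le hx.1] at ht
  have ht' : t ∈ Icc 0 T := ⟨ht.1.le, ht.2.trans hx.2⟩
  refine norm_add_mul_le ((H lam₀).norm_right_le hT hg ht') ((H lam).norm_left_le hT hg ht')
    ((H lam₀).norm_left_le hT hg ht') ((H lam).norm_right_le hT hg ht') ?_ (norm_phase _ _)
  rw [RCLike.norm_conj, norm_phase]

/-- The transfer vector tends to `(1, 0)` as `lam → lam₀`, because its deviation is `lam - lam₀`
times a bounded integral. -/
theorem continuous_left (H : ∀ lam, IsReducedSolution g T lam (a lam) (b lam)) (hT : 0 ≤ T)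
    (hg : IntervalIntegrable g volume 0 T) {x : ℝ} (hx : x ∈ Icc 0 T) :
    Continuous fun lam => a lam x := by
  refine continuous_iff_continuousAt.2 fun lam₀ => ?_
  have hx' : x ∈ uIcc 0 T := by rwa [uIcc_of_le hT]
  have h1 := (((tendsto_transferLeft (lam₀ := lam₀) H hT hg hx).const_mul (a lam₀ x)).add
    ((tendsto_transferRight (lam₀ := lam₀) H hT hg hx).const_mul (conj (b lam₀ x)))).mul
    (tendsto_phase_sub lam₀ x)
  rw [mul_one, mul_zero, add_zero, mul_one] at h1
  refine h1.congr fun lam => ?_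
  rw [← (H lam₀).conj_phase_mul_left (lam - lam₀) (a lam) (b lam) hx']
  linear_combination a lam x * phase_mul_conj (lam - lam₀) x

theorem continuous_right (H : ∀ lam, IsReducedSolution g T lam (a lam) (b lam)) (hT : 0 ≤ T)
    (hg : IntervalIntegrable g volume 0 T) {x : ℝ} (hx : x ∈ Icc 0 T) :
    Continuous fun lam => b lam x := by
  refine continuous_iff_continuousAt.2 fun lam₀ => ?_
  have hx' : x ∈ uIcc 0 T := by rwa [uIcc_of_le hT]
  have h1 := (((tendsto_transferLeft (lam₀ := lam₀) H hT hg hx).const_mul (b lam₀ x)).add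
    ((tendsto_transferRight (lam₀ := lam₀) H hT hg hx).const_mul (conj (a lam₀ x)))).mul
    ((Complex.continuous_conj.tendsto _).comp (tendsto_phase_sub lam₀ x))
  rw [map_one, mul_one, mul_zero, add_zero, mul_one] at h1
  refine h1.congr fun lam => ?_
  rw [← (H lam₀).phase_mul_right (lam - lam₀) (a lam) (b lam) hx', Function.comp_apply]
  linear_combination b lam x * phase_mul_conj (lam - lam₀) x

theorem continuous_logLeft (H : ∀ lam, IsReducedSolution g T lam (a lam) (b lam)) (hT : 0 ≤ T)
    (hg : IntervalIntegrable g volume 0 T) :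
    Continuous fun lam => logLeft g lam (a lam) (b lam) T := by
  refine continuous_iff_continuousAt.2 fun lam₀ => ?_
  refine intervalIntegral.continuousAt_of_dominated_interval (bound := fun t => ‖g t‖)
    (Eventually.of_forall fun lam =>
      ((H lam).intervalIntegrable_logDeriv hg).def'.aestronglyMeasurable)
    (Eventually.of_forall fun lam => Eventually.of_forall fun t ht =>
      (H lam).norm_logDeriv_le (uIoc_subset_uIcc ht)) hg.norm
    (Eventually.of_forall fun t ht => ?_)
  have ht' : t ∈ Icc 0 T := by
    rw [uIoc_of_le hT] at ht
    exact Ioc_subset_Icc_self ht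
  refine ((continuousAt_const.mul ((continuous_phase_left t).comp
    (continuous_const.mul continuous_id)).continuousAt).mul
    ((continuous_right H hT hg ht').continuousAt.div (continuous_left H hT hg ht').continuousAt
      ((H lam₀).ne_zero (uIoc_subset_uIcc ht))))

/-- The derivative of the monodromy with respect to the spectral parameter. -/
theorem hasDerivAt_conj_phase_mul_left (H : ∀ lam, IsReducedSolution g T lam (a lam) (b lam))
    (hT : 0 ≤ T) (hg : IntervalIntegrable g volume 0 T) :
    HasDerivAt (fun lam => conj (phase lam T) * a lam T)
      (conj (phase lam₀ T) * Complex.I *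
        (conj (b lam₀ T) * (∫ t in (0 : ℝ)..T, 2 * (a lam₀ t * b lam₀ t))
          - a lam₀ T * ((∫ t in (0 : ℝ)..T, (‖a lam₀ t‖ ^ 2 + ‖b lam₀ t‖ ^ 2) : ℝ) : ℂ)))
      lam₀ := by
  have hcont : ∀ (lam : ℝ), ContinuousOn (a lam) (uIcc 0 T) ∧ ContinuousOn (b lam) (uIcc 0 T) :=
    fun lam => ⟨(H lam).left.continuousOn, (H lam).right.continuousOn⟩
  have hph : ∀ δ : ℝ, ContinuousOn (phase δ) (uIcc 0 T) := fun δ =>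
    (continuous_phase δ).continuousOn
  have hcc : ∀ {u : ℝ → ℂ}, ContinuousOn u (uIcc 0 T) →
      ContinuousOn (fun t => conj (u t)) (uIcc 0 T) := fun hu =>
    Complex.continuous_conj.comp_continuousOn hu
  have hphc : ∀ t, ContinuousAt (fun lam => phase (lam - lam₀) t) lam₀ := fun t =>
    ((continuous_phase_left t).comp (continuous_id.sub continuous_const)).continuousAt
  have hN : ContinuousAt (fun lam => ∫ t in (0 : ℝ)..T,
      (conj (a lam₀ t) * (conj (phase (lam - lam₀) t) * a lam t)
        + conj (b lam₀ t) * (phase (lam - lam₀) t * b lam t))) lam₀ := by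
    refine intervalIntegral.continuousAt_of_dominated_interval
      (bound := fun _ => 2 * Real.exp (∫ t in (0 : ℝ)..T, ‖g t‖) ^ 2)
      (Eventually.of_forall fun lam => ?_)
      (Eventually.of_forall fun lam => Eventually.of_forall fun t ht => ?_)
      intervalIntegrable_const (Eventually.of_forall fun t ht => ?_)
    · exact (((hcc (hcont lam₀).1).mul ((hcc (hph _)).mul (hcont lam).1)).add
        ((hcc (hcont lam₀).2).mul ((hph _).mul (hcont lam).2))).intervalIntegrable
        |>.def'.aestronglyMeasurable
    · rw [uIoc_of_le hT] at ht
      have ht' := Ioc_subset_Icc_self ht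
      refine norm_add_mul_le ?_ ((H lam).norm_left_le hT hg ht') ?_
        ((H lam).norm_right_le hT hg ht') ?_ (norm_phase _ _)
      · rw [RCLike.norm_conj]
        exact (H lam₀).norm_left_le hT hg ht'
      · rw [RCLike.norm_conj]
        exact (H lam₀).norm_right_le hT hg ht'
      · rw [RCLike.norm_conj, norm_phase]
    · rw [uIoc_of_le hT] at ht
      have ht' := Ioc_subset_Icc_self ht
      exact (continuousAt_const.mul ((Complex.continuous_conj.continuousAt.comp (hphc t)).mul
        (continuous_left H hT hg ht').continuousAt)).add (continuousAt_const.mul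
        ((hphc t).mul (continuous_right H hT hg ht').continuousAt))
  have hN' : ContinuousAt (fun lam => ∫ t in (0 : ℝ)..T,
      (b lam₀ t * (conj (phase (lam - lam₀) t) * a lam t)
        + a lam₀ t * (phase (lam - lam₀) t * b lam t))) lam₀ := by
    refine intervalIntegral.continuousAt_of_dominated_interval
      (bound := fun _ => 2 * Real.exp (∫ t in (0 : ℝ)..T, ‖g t‖) ^ 2)
      (Eventually.of_forall fun lam => ?_)
      (Eventually.of_forall fun lam => Eventually.of_forall fun t ht => ?_)
      intervalIntegrable_const (Eventually.of_forall fun t ht => ?_)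
    · exact (((hcont lam₀).2.mul ((hcc (hph _)).mul (hcont lam).1)).add
        ((hcont lam₀).1.mul ((hph _).mul (hcont lam).2))).intervalIntegrable
        |>.def'.aestronglyMeasurable
    · rw [uIoc_of_le hT] at ht
      have ht' := Ioc_subset_Icc_self ht
      refine norm_add_mul_le ((H lam₀).norm_right_le hT hg ht') ((H lam).norm_left_le hT hg ht')
        ((H lam₀).norm_left_le hT hg ht') ((H lam).norm_right_le hT hg ht') ?_ (norm_phase _ _)
      rw [RCLike.norm_conj, norm_phase]
    · rw [uIoc_of_le hT] at ht
      have ht' := Ioc_subset_Icc_self ht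
      exact (continuousAt_const.mul ((Complex.continuous_conj.continuousAt.comp (hphc t)).mul
        (continuous_left H hT hg ht').continuousAt)).add (continuousAt_const.mul
        ((hphc t).mul (continuous_right H hT hg ht').continuousAt))
  -- Each transfer entry is a constant plus `lam - lam₀` times a function continuous at `lam₀`, so
  -- its derivative there is read off from the value of that function.
  have hl := (hasDerivAt_sub_mul_of_continuousAt hN).const_mul (-Complex.I)
  have hr := (hasDerivAt_sub_mul_of_continuousAt hN').const_mul Complex.I
  have h := (((hl.const_add 1).const_mul (a lam₀ T)).add
    (hr.const_mul (conj (b lam₀ T)))).const_mul (conj (phase lam₀ T))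
  refine (h.congr_of_eventuallyEq (Eventually.of_forall fun lam => ?_)).congr_deriv ?_
  · have e1 := (H lam₀).conj_phase_mul_left (lam - lam₀) (a lam) (b lam) right_mem_uIcc
    rw [transferLeft_eq (H lam₀) (H lam) right_mem_uIcc,
      transferRight_eq (H lam₀) (H lam) right_mem_uIcc] at e1
    have e2 : phase lam T = phase lam₀ T * phase (lam - lam₀) T := by
      rw [← phase_add]
      congr 1
      ring
    simp only [Pi.add_apply]
    rw [e2, map_mul, mul_assoc, e1]
    ring
  · have e0 : ∀ t, phase (lam₀ - lam₀) t = 1 := fun t => by simp [phase]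
    have k1 : ∫ t in (0 : ℝ)..T, (conj (a lam₀ t) * (conj (phase (lam₀ - lam₀) t) * a lam₀ t)
        + conj (b lam₀ t) * (phase (lam₀ - lam₀) t * b lam₀ t))
        = ((∫ t in (0 : ℝ)..T, (‖a lam₀ t‖ ^ 2 + ‖b lam₀ t‖ ^ 2) : ℝ) : ℂ) := by
      rw [← intervalIntegral.integral_ofReal]
      refine intervalIntegral.integral_congr fun t _ => ?_
      simp only [e0, map_one, one_mul]
      push_cast
      rw [← Complex.conj_mul', ← Complex.conj_mul']
    have k2 : ∫ t in (0 : ℝ)..T, (b lam₀ t * (conj (phase (lam₀ - lam₀) t) * a lam₀ t)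
        + a lam₀ t * (phase (lam₀ - lam₀) t * b lam₀ t))
        = ∫ t in (0 : ℝ)..T, 2 * (a lam₀ t * b lam₀ t) := by
      refine intervalIntegral.integral_congr fun t _ => ?_
      simp only [e0, map_one, one_mul]
      ring
    rw [k1, k2]
    ring

end continuity

end IsReducedSolution

end DiracSystem

/-! ### The speed estimate, its equality case, and rigidity of the reduced system. -/

namespace DiracSystem

open Set Filter Topology ComplexConjugate

/-- The hyperbolic identity behind the comparison of speeds: if `h² - j² = 1`, then
`h y - B j` dominates `√(y² - B²)`. -/
theorem hyperbolic_sq (h j y B : ℝ) (hj : h ^ 2 - j ^ 2 = 1) :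
    (h * y - B * j) ^ 2 = (y ^ 2 - B ^ 2) + (y * j - h * B) ^ 2 := by
  linear_combination (y ^ 2 - B ^ 2) * hj

theorem hyperbolic_pos {h j y B : ℝ} (hh : 0 < h) (hj0 : 0 ≤ j) (hj : h ^ 2 - j ^ 2 = 1)
    (hy : 0 < y) (hyB : B ≤ y) : 0 < h * y - B * j := by
  have h1 : j < h := by nlinarith
  have h2 : B * j ≤ y * j := mul_le_mul_of_nonneg_right hyB hj0
  nlinarith

theorem sqrt_le_hyperbolic {h j y B : ℝ} (hh : 0 < h) (hj0 : 0 ≤ j) (hj : h ^ 2 - j ^ 2 = 1)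
    (hy : 0 < y) (hyB : B ≤ y) : √(y ^ 2 - B ^ 2) ≤ h * y - B * j := by
  refine Real.sqrt_le_iff.2 ⟨(hyperbolic_pos hh hj0 hj hy hyB).le, ?_⟩
  rw [hyperbolic_sq h j y B hj]
  linarith [sq_nonneg (y * j - h * B)]

namespace IsReducedSolution

variable {g : ℝ → ℂ} {T : ℝ}

section single

variable {lam : ℝ} {a b : ℝ → ℂ}

/-- The left side is `(|a|² - |b|²)²`. It supplies the pair `(h, j)` for the hyperbolic inequality.
-/
theorem hyperbolic_normal (h : IsReducedSolution g T lam a b) {x : ℝ} (hx : x ∈ uIcc 0 T) :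
    (‖a x‖ ^ 2 + ‖b x‖ ^ 2) ^ 2 - (2 * (‖a x‖ * ‖b x‖)) ^ 2 = 1 := by
  have h1 := h.norm_sq_sub hx
  have h2 : (‖a x‖ ^ 2 - ‖b x‖ ^ 2) ^ 2 = 1 := by rw [h1, one_pow]
  linarith

theorem hyperbolic_normal_pos (h : IsReducedSolution g T lam a b) {x : ℝ} (hx : x ∈ uIcc 0 T) :
    0 < ‖a x‖ ^ 2 + ‖b x‖ ^ 2 := by
  have h1 := h.one_le_norm hx
  positivity

theorem continuousOn_speed (h : IsReducedSolution g T lam a b) (y B : ℝ) :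
    ContinuousOn (fun x => (‖a x‖ ^ 2 + ‖b x‖ ^ 2) * y - B * (2 * (‖a x‖ * ‖b x‖)))
      (uIcc 0 T) := by
  have h1 := h.left.continuousOn.norm
  have h2 := h.right.continuousOn.norm
  fun_prop

theorem norm_integral_mul_le (a b : ℝ → ℂ) (hT : 0 ≤ T) :
    ‖∫ t in (0 : ℝ)..T, 2 * (a t * b t)‖ ≤ ∫ t in (0 : ℝ)..T, 2 * (‖a t‖ * ‖b t‖) := by
  refine (intervalIntegral.norm_integral_le_integral_norm hT).trans (le_of_eq ?_)
  simp

theorem integral_speed (h : IsReducedSolution g T lam a b) (y B : ℝ) :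
    ∫ t in (0 : ℝ)..T, ((‖a t‖ ^ 2 + ‖b t‖ ^ 2) * y - B * (2 * (‖a t‖ * ‖b t‖)))
      = (∫ t in (0 : ℝ)..T, (‖a t‖ ^ 2 + ‖b t‖ ^ 2)) * y
        - B * ∫ t in (0 : ℝ)..T, 2 * (‖a t‖ * ‖b t‖) := by
  have h1 := h.left.continuousOn.norm
  have h2 := h.right.continuousOn.norm
  rw [intervalIntegral.integral_sub, intervalIntegral.integral_mul_const,
    intervalIntegral.integral_const_mul]
  · exact ContinuousOn.intervalIntegrable (by fun_prop)
  · exact ContinuousOn.intervalIntegrable (by fun_prop)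

theorem integral_speed_pos (h : IsReducedSolution g T lam a b) (hT : 0 < T) {y B : ℝ} (hy : 0 < y)
    (hyB : B ≤ y) : 0 < (∫ t in (0 : ℝ)..T, (‖a t‖ ^ 2 + ‖b t‖ ^ 2)) * y
        - B * ∫ t in (0 : ℝ)..T, 2 * (‖a t‖ * ‖b t‖) := by
  rw [← h.integral_speed]
  have hc := h.continuousOn_speed y B
  rw [uIcc_of_le hT.le] at hc
  have hp : ∀ x ∈ Icc 0 T,
      0 < (‖a x‖ ^ 2 + ‖b x‖ ^ 2) * y - B * (2 * (‖a x‖ * ‖b x‖)) := fun x hx => by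
    have hx' : x ∈ uIcc 0 T := by rwa [uIcc_of_le hT.le]
    exact hyperbolic_pos (h.hyperbolic_normal_pos hx') (by positivity) (h.hyperbolic_normal hx')
      hy hyB
  exact intervalIntegral.integral_pos hT hc (fun x hx => (hp x (Ioc_subset_Icc_self hx)).le)
    ⟨0, left_mem_Icc.2 hT.le, hp 0 (left_mem_Icc.2 hT.le)⟩

theorem le_integral_speed (h : IsReducedSolution g T lam a b) (hT : 0 < T) {y B : ℝ} (hy : 0 < y)
    (hyB : B ≤ y) : T * √(y ^ 2 - B ^ 2) ≤
      (∫ t in (0 : ℝ)..T, (‖a t‖ ^ 2 + ‖b t‖ ^ 2)) * y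
        - B * ∫ t in (0 : ℝ)..T, 2 * (‖a t‖ * ‖b t‖) := by
  rw [← h.integral_speed]
  have h1 : ∫ _ in (0 : ℝ)..T, √(y ^ 2 - B ^ 2) = T * √(y ^ 2 - B ^ 2) := by simp
  rw [← h1]
  refine intervalIntegral.integral_mono_on hT.le intervalIntegrable_const
    (h.continuousOn_speed y B).intervalIntegrable fun x hx => ?_
  have hx' : x ∈ uIcc 0 T := by rwa [uIcc_of_le hT.le]
  exact sqrt_le_hyperbolic (h.hyperbolic_normal_pos hx') (by positivity)
    (h.hyperbolic_normal hx') hy hyB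

/-- Minimal total speed forces the second component to vanish. -/
theorem right_eq_zero_of_integral_speed_le (h : IsReducedSolution g T lam a b) (hT : 0 < T)
    {y B : ℝ} (hy : 0 < y) (hB : 0 ≤ B) (hyB : B ≤ y)
    (hle : (∫ t in (0 : ℝ)..T, (‖a t‖ ^ 2 + ‖b t‖ ^ 2)) * y
        - B * (∫ t in (0 : ℝ)..T, 2 * (‖a t‖ * ‖b t‖)) ≤ T * √(y ^ 2 - B ^ 2)) :
    ∀ x ∈ Icc 0 T, b x = 0 := by
  have hmem : ∀ x ∈ Icc 0 T, x ∈ uIcc 0 T := fun x hx => by rwa [uIcc_of_le hT.le]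
  -- A continuous integrand that is at least a constant and whose integral is no larger equals this
  -- constant everywhere.
  have key : ∀ x ∈ Icc 0 T,
      (‖a x‖ ^ 2 + ‖b x‖ ^ 2) * y - B * (2 * (‖a x‖ * ‖b x‖)) = √(y ^ 2 - B ^ 2) := by
    by_contra! hne
    obtain ⟨c, hc, hc'⟩ := hne
    have hge : ∀ x ∈ Icc 0 T, √(y ^ 2 - B ^ 2)
        ≤ (‖a x‖ ^ 2 + ‖b x‖ ^ 2) * y - B * (2 * (‖a x‖ * ‖b x‖)) := fun x hx =>
      sqrt_le_hyperbolic (h.hyperbolic_normal_pos (hmem x hx)) (by positivity)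
        (h.hyperbolic_normal (hmem x hx)) hy hyB
    have hcont := h.continuousOn_speed y B
    have hpos := intervalIntegral.integral_pos hT
      (f := fun x => ((‖a x‖ ^ 2 + ‖b x‖ ^ 2) * y - B * (2 * (‖a x‖ * ‖b x‖))) - √(y ^ 2 - B ^ 2))
      ((uIcc_of_le hT.le ▸ hcont).sub continuousOn_const)
      (fun x hx => sub_nonneg.2 (hge x (Ioc_subset_Icc_self hx)))
      ⟨c, hc, sub_pos.2 (lt_of_le_of_ne (hge c hc) hc'.symm)⟩
    rw [intervalIntegral.integral_sub hcont.intervalIntegrable intervalIntegrable_const,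
      h.integral_speed] at hpos
    simp only [intervalIntegral.integral_const, smul_eq_mul, sub_zero] at hpos
    linarith
  -- Equality in the hyperbolic inequality kills the square `(y j - h B)²`.
  have hsq : ∀ x ∈ Icc 0 T, y * (2 * (‖a x‖ * ‖b x‖)) = (‖a x‖ ^ 2 + ‖b x‖ ^ 2) * B := by
    intro x hx
    have h1 := hyperbolic_sq _ _ y B (h.hyperbolic_normal (hmem x hx))
    rw [key x hx, Real.sq_sqrt (by nlinarith)] at h1
    have h2 : (y * (2 * (‖a x‖ * ‖b x‖)) - (‖a x‖ ^ 2 + ‖b x‖ ^ 2) * B) ^ 2 = 0 := by linarith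
    exact sub_eq_zero.1 (pow_eq_zero_iff two_ne_zero |>.1 h2)
  -- At `x = 0` one has `j = 0` and `h = 1`; then `B = 0` gives `j = 0` everywhere.
  have hB0 : B = 0 := by
    have h1 := hsq 0 (left_mem_Icc.2 hT.le)
    simpa [h.left_zero, h.right_zero] using h1.symm
  intro x hx
  have h1 := hsq x hx
  have h2 := h.ne_zero (hmem x hx)
  simpa [hB0, hy.ne', h2] using h1

theorem coefficient_eq_zero (h : IsReducedSolution g T lam a b) (hT : 0 < T)
    (hb : ∀ x ∈ Icc 0 T, b x = 0) : ∀ᵐ x : ℝ, x ∈ Ioo 0 T → g x = 0 := by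
  filter_upwards [h.right.deriv] with x hx hx'
  have hxI : x ∈ uIcc 0 T := by
    rw [uIcc_of_le hT.le]
    exact Ioo_subset_Icc_self hx'
  have h1 := hx hxI
  have h2 : HasDerivAt b 0 x := by
    refine (hasDerivAt_const x (0 : ℂ)).congr_of_eventuallyEq ?_
    filter_upwards [Ioo_mem_nhds hx'.1 hx'.2] with z hz using hb z (Ioo_subset_Icc_self hz)
  have h3 := h1.unique h2
  have h4 : phase (2 * lam) x ≠ 0 := fun h0 => by
    have := norm_phase (2 * lam) x
    rw [h0] at this
    simp at this
  simpa [h.ne_zero hxI, h4] using h3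

end single

variable {a b : ℝ → ℝ → ℂ}

/-- A continuous logarithm differs near `lam₀` from the principal logarithm of the normalized
quotient by a constant, so its derivative is the logarithmic derivative. -/
theorem hasDerivAt_logLeft (H : ∀ lam, IsReducedSolution g T lam (a lam) (b lam)) (hT : 0 ≤ T)
    (hg : IntervalIntegrable g volume 0 T) {lam₀ : ℝ} {z : ℂ}
    (hz : HasDerivAt (fun lam => conj (phase lam T) * a lam T) z lam₀) :
    HasDerivAt (fun lam : ℝ => logLeft g lam (a lam) (b lam) T - (lam * T : ℝ) * Complex.I)
      (z / (conj (phase lam₀ T) * a lam₀ T)) lam₀ := by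
  set Λ : ℝ → ℂ := fun lam => logLeft g lam (a lam) (b lam) T - (lam * T : ℝ) * Complex.I with hΛ
  have hc : Continuous Λ := (continuous_logLeft H hT hg).sub (by fun_prop)
  have hexp : ∀ lam, Complex.exp (Λ lam) = conj (phase lam T) * a lam T := fun lam => by
    rw [hΛ, ← (H lam).exp_logLeft hg right_mem_uIcc, phase, ← Complex.exp_conj, ← Complex.exp_add]
    congr 1
    rw [map_mul, Complex.conj_I, Complex.conj_ofReal]
    ring
  have hne : conj (phase lam₀ T) * a lam₀ T ≠ 0 := by
    rw [← hexp]
    exact Complex.exp_ne_zero _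
  have h1 : HasDerivAt (fun lam => Complex.log (Complex.exp (Λ lam - Λ lam₀)))
      (z / (conj (phase lam₀ T) * a lam₀ T)) lam₀ := by
    have h2 : HasDerivAt (fun lam => Complex.exp (Λ lam - Λ lam₀))
        (z / (conj (phase lam₀ T) * a lam₀ T)) lam₀ := by
      refine (hz.div_const _).congr_of_eventuallyEq (Eventually.of_forall fun lam => ?_)
      simp only [Complex.exp_sub, hexp]
    have h3 := h2.clog_real (by simp)
    simpa using h3
  have h2 : ∀ᶠ lam in 𝓝 lam₀, Λ lam = Λ lam₀ + Complex.log (Complex.exp (Λ lam - Λ lam₀)) := by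
    have h3 : Continuous fun lam => (Λ lam - Λ lam₀).im :=
      Complex.continuous_im.comp (hc.sub continuous_const)
    have h4 : ∀ᶠ lam in 𝓝 lam₀, (Λ lam - Λ lam₀).im ∈ Ioo (-Real.pi) Real.pi := by
      refine h3.continuousAt.eventually_mem (Ioo_mem_nhds ?_ ?_) <;> simp [Real.pi_pos]
    filter_upwards [h4] with lam h5
    rw [Complex.log_exp h5.1 h5.2.le]
    ring
  exact (h1.const_add (Λ lam₀)).congr_of_eventuallyEq h2

/-- If `|Re (exp (i c) exp (-i lam T) a lam T)| ≤ 1` for all real `lam`, then the coefficient of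
the reduced system vanishes. -/
theorem coefficient_eq_zero_of_abs_re_le_one
    (H : ∀ lam, IsReducedSolution g T lam (a lam) (b lam)) (hT : 0 < T)
    (hg : IntervalIntegrable g volume 0 T) (c : ℝ)
    (hle : ∀ lam, |(phase c 1 * (conj (phase lam T) * a lam T)).re| ≤ 1) :
    ∀ᵐ x : ℝ, x ∈ Ioo 0 T → g x = 0 := by
  set A : ℝ → ℂ := fun lam => phase c 1 * (conj (phase lam T) * a lam T) with hA
  set k : ℝ → ℝ := fun lam => ∫ t in (0 : ℝ)..T, (‖a lam t‖ ^ 2 + ‖b lam t‖ ^ 2) with hk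
  set κ : ℝ → ℂ := fun lam => ∫ t in (0 : ℝ)..T, 2 * (a lam t * b lam t) with hκ
  set κ' : ℝ → ℝ := fun lam => ∫ t in (0 : ℝ)..T, 2 * (‖a lam t‖ * ‖b lam t‖) with hκ'
  set β : ℝ → ℂ := fun lam => phase c 1 * (conj (phase lam T) * conj (b lam T)) with hβ
  have hκle : ∀ lam, ‖κ lam‖ ≤ κ' lam := fun lam => norm_integral_mul_le _ _ hT.le
  have hβn : ∀ lam, ‖β lam‖ = ‖b lam T‖ := fun lam => by simp [hβ, norm_phase]
  have hAn : ∀ lam, ‖A lam‖ = ‖a lam T‖ := fun lam => by simp [hA, norm_phase]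
  have hA1 : ∀ lam, 1 ≤ ‖A lam‖ := fun lam => by
    rw [hAn]
    exact (H lam).one_le_norm right_mem_uIcc
  have hAβ : ∀ lam, (A lam).re ^ 2 + (A lam).im ^ 2 - ‖β lam‖ ^ 2 = 1 := fun lam => by
    have e := Complex.sq_norm (A lam)
    rw [Complex.normSq_apply] at e
    rw [hβn, ← (H lam).norm_sq_sub right_mem_uIcc, ← hAn, e]
    ring
  have hAd : ∀ lam, HasDerivAt A (Complex.I * (β lam * κ lam - A lam * k lam)) lam := fun lam => by
    refine ((hasDerivAt_conj_phase_mul_left (lam₀ := lam) H hT.le hg).const_mul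
      (phase c 1)).congr_deriv ?_
    simp only [hβ, hA, hκ, hk]
    ring
  have hfd : ∀ lam, HasDerivAt (fun lam => (A lam).re)
      (k lam * (A lam).im - (β lam * κ lam).im) lam := fun lam => by
    refine (Complex.reCLM.hasFDerivAt.comp_hasDerivAt lam (hAd lam)).congr_deriv ?_
    simp only [Complex.reCLM_apply, Complex.mul_re, Complex.mul_im, Complex.sub_re, Complex.sub_im,
      Complex.I_re, Complex.I_im, Complex.ofReal_re, Complex.ofReal_im]
    ring
  have him : ∀ lam, |(β lam * κ lam).im| ≤ ‖β lam‖ * κ' lam := fun lam => by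
    refine (Complex.abs_im_le_norm _).trans ?_
    rw [norm_mul]
    exact mul_le_mul_of_nonneg_left (hκle lam) (norm_nonneg _)
  set Λ : ℝ → ℂ := fun lam : ℝ =>
    logLeft g lam (a lam) (b lam) T - (lam * T : ℝ) * Complex.I with hΛ
  have hexp : ∀ lam, Complex.exp (Λ lam + c * Complex.I) = A lam := fun lam => by
    simp only [hΛ, hA]
    rw [← (H lam).exp_logLeft hg right_mem_uIcc, phase, phase, ← Complex.exp_conj,
      ← Complex.exp_add, ← Complex.exp_add]
    congr 1
    rw [map_mul, Complex.conj_I, Complex.conj_ofReal, mul_one]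
    ring
  -- Minus a continuous argument of `A`, hence `A = |A| e^{-iψ}`; it is increasing and close to `T
  -- lam - c` at both ends.
  set ψ : ℝ → ℝ := fun lam => -(Λ lam).im - c with hψ
  have hψd : ∀ lam, HasDerivAt ψ
      (-(Complex.I * (β lam * κ lam - A lam * k lam) / A lam).im) lam := fun lam => by
    have h1 := hasDerivAt_logLeft H hT.le hg (hasDerivAt_conj_phase_mul_left (lam₀ := lam) H hT.le hg)
    refine ((Complex.imCLM.hasFDerivAt.comp_hasDerivAt lam h1).neg.sub_const c).congr_deriv ?_
    rw [Complex.imCLM_apply]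
    congr 2
    have hp : phase c 1 ≠ 0 := fun h0 => by
      have := norm_phase c 1
      rw [h0] at this
      simp at this
    have e : A lam = phase c 1 * (conj (phase lam T) * a lam T) := rfl
    rw [e, ← mul_div_mul_left _ (conj (phase lam T) * a lam T) hp]
    congr 1
    simp only [hβ, hκ, hk]
    ring
  have hA0 : ∀ lam, A lam ≠ 0 := fun lam h0 => by
    have := hA1 lam
    rw [h0] at this
    norm_num at this
  -- The derivative is `k - Re (β κ / A)`, at least `k - κ'` because `|β| ≤ |A|`; this is the speed
  -- integral with `y = B = 1`.
  have hψpos : ∀ lam, 0 < -(Complex.I * (β lam * κ lam - A lam * k lam) / A lam).im := by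
    intro lam
    have e : Complex.I * (β lam * κ lam - A lam * k lam) / A lam
        = Complex.I * (β lam * κ lam / A lam - k lam) := by
      have := hA0 lam
      field_simp
    have e2 : -(Complex.I * (β lam * κ lam / A lam - k lam)).im
        = k lam - (β lam * κ lam / A lam).re := by
      simp [Complex.mul_im]
    rw [e, e2]
    have h1 : (β lam * κ lam / A lam).re ≤ κ' lam := by
      refine (Complex.re_le_norm _).trans ?_
      rw [norm_div, norm_mul, hβn, hAn, div_le_iff₀ (lt_of_lt_of_le one_pos (hAn lam ▸ hA1 lam)),
        mul_comm]
      exact mul_le_mul (hκle lam) ((H lam).norm_lt_norm right_mem_uIcc).le (norm_nonneg _)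
        ((norm_nonneg _).trans (hκle lam))
    have h2 := (H lam).integral_speed_pos hT one_pos le_rfl
    linarith
  have hψc : Continuous ψ := continuous_iff_continuousAt.2 fun lam => (hψd lam).continuousAt
  have hψm : StrictMono ψ := strictMono_of_deriv_pos fun lam => by
    rw [(hψd lam).deriv]
    exact hψpos lam
  have hlim : ∀ l : Filter ℝ, l.IsCountablyGenerated → l ≤ cocompact ℝ →
      Tendsto (fun x => ψ x - (T * x - c)) l (𝓝 0) := by
    intro l _ hl
    have h1 := ((Complex.continuous_im.tendsto _).comp (tendsto_logLeft H hT.le hg hl)).neg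
    rw [Complex.zero_im, neg_zero] at h1
    refine h1.congr fun lam => ?_
    simp only [hψ, hΛ, Function.comp_apply, Complex.sub_im, Complex.mul_im, Complex.ofReal_re,
      Complex.ofReal_im, Complex.I_re, Complex.I_im]
    ring
  have hre : ∀ lam, (A lam).re = ‖A lam‖ * Real.cos (ψ lam) := fun lam => by
    rw [← hexp, Complex.norm_exp, Complex.exp_re, ← Real.cos_neg (ψ lam)]
    congr 2
    simp [hψ, add_comm]
  have himA : ∀ lam, (A lam).im = -(‖A lam‖ * Real.sin (ψ lam)) := fun lam => by
    rw [← hexp, Complex.norm_exp, Complex.exp_im, ← mul_neg, ← Real.sin_neg (ψ lam)]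
    congr 2
    simp [hψ, add_comm]
  have hsq : ∀ lam, 1 - (A lam).re ^ 2 = (A lam).im ^ 2 - ‖β lam‖ ^ 2 := fun lam => by
    linarith [hAβ lam]
  -- Stability enters here: `(Im A)² - |β|² = 1 - (Re A)² ≥ 0`.
  have hBy : ∀ lam, ‖β lam‖ ≤ |(A lam).im| := fun lam => by
    refine abs_le_of_sq_le_sq' ?_ (abs_nonneg _) |>.2
    rw [sq_abs]
    have h1 := hle lam
    rw [← sq_le_one_iff_abs_le_one] at h1
    linarith [hAβ lam]
  obtain ⟨lam, hs, -, heq⟩ := exists_deriv_eq_of_phase_asymptotic (f := fun lam => (A lam).re)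
    (R := fun lam => ‖A lam‖) hT hfd hle hψm hψc (hlim _ inferInstance atTop_le_cocompact)
    (hlim _ inferInstance atBot_le_cocompact) hA1 hre (fun lam hs => by
      have hy : 0 < (A lam).im := by
        rw [himA]
        nlinarith [hA1 lam]
      have hB := hBy lam
      rw [abs_of_pos hy] at hB
      have h1 := (H lam).integral_speed_pos hT hy hB
      have h2 := (H lam).le_integral_speed hT hy hB
      have h3 := le_abs_self (β lam * κ lam).im
      have h4 := him lam
      rw [hsq]
      constructor <;> linarith) (fun lam hs => by
      have hy : 0 < -(A lam).im := by
        rw [himA]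
        nlinarith [hA1 lam]
      have hB := hBy lam
      rw [abs_of_neg (neg_pos.1 hy)] at hB
      have h1 := (H lam).integral_speed_pos hT hy hB
      have h2 := (H lam).le_integral_speed hT hy hB
      have h3 := neg_abs_le (β lam * κ lam).im
      have h4 := him lam
      rw [neg_sq] at h2
      rw [hsq]
      constructor <;> linarith)
  have hy : 0 < -(A lam).im := by
    rw [himA]
    nlinarith [hA1 lam]
  have hB := hBy lam
  rw [abs_of_neg (neg_pos.1 hy)] at hB
  -- At this `lam` the speed integral is at most `-f' = T √(1 - f²)`, so it is minimal.
  refine (H lam).coefficient_eq_zero hT ((H lam).right_eq_zero_of_integral_speed_le hT hy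
    (norm_nonneg (β lam)) hB ?_)
  have h3 := neg_abs_le (β lam * κ lam).im
  have h4 := him lam
  rw [neg_sq, ← hsq]
  linarith

end IsReducedSolution

end DiracSystem

namespace DiracSystem

open Set Filter Topology ComplexConjugate

/-! ### Almost everywhere periodic functions. -/

section periodicity

variable {X : Type*} {f : ℝ → X} {c : ℝ}

theorem ae_add_right {p : ℝ → Prop} (h : ∀ᵐ x : ℝ, p x) (d : ℝ) : ∀ᵐ x : ℝ, p (x + d) :=
  (measurePreserving_add_right volume d).quasiMeasurePreserving.ae h

theorem ae_forall_int_of_ae_periodic (h : ∀ᵐ x : ℝ, f (x + c) = f x) :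
    ∀ᵐ x : ℝ, ∀ n : ℤ, f (x + n * c) = f x := by
  have h1 : ∀ᵐ x : ℝ, ∀ n : ℤ, f (x + n * c + c) = f (x + n * c) :=
    ae_all_iff.2 fun n => ae_add_right h (n * c)
  filter_upwards [h1] with x hx n
  induction n using Int.induction_on with
  | zero => simp
  | succ k ih =>
    rw [← ih, ← hx k]
    congr 1
    push_cast
    ring
  | pred k ih =>
    rw [← ih, ← hx (-k - 1)]
    congr 1
    push_cast
    ring

theorem ae_of_ae_Ioo_of_ae_periodic {p : X → Prop} (hc : 0 < c)
    (h : ∀ᵐ x : ℝ, f (x + c) = f x) (hp : ∀ᵐ x : ℝ, x ∈ Ioo 0 c → p (f x)) :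
    ∀ᵐ x : ℝ, p (f x) := by
  -- The property is known only on the open period, so the points of `c ℤ` are discarded.
  have h0 : ∀ᵐ x : ℝ, x ≠ 0 := by simp [ae_iff, measure_singleton]
  filter_upwards [ae_forall_int_of_ae_periodic h,
    ae_all_iff.2 fun n : ℤ => ae_add_right hp (n * c),
    ae_all_iff.2 fun n : ℤ => ae_add_right h0 (n * c)] with x h1 h2 h3
  obtain ⟨n, hn, -⟩ := existsUnique_add_zsmul_mem_Ico hc x 0
  rw [zsmul_eq_mul, zero_add] at hn
  rw [← h1 n]
  exact h2 n ⟨lt_of_le_of_ne hn.1 (h3 n).symm, hn.2⟩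

/-- An almost everywhere periodic function is almost everywhere equal to a periodic one that has
the same values on a period. -/
theorem exists_periodic_ae_eq (hc : 0 < c) (h : ∀ᵐ x : ℝ, f (x + c) = f x) :
    ∃ F : ℝ → X, Function.Periodic F c ∧ EqOn F f (Ico 0 c) ∧ ∀ᵐ x : ℝ, F x = f x := by
  refine ⟨fun x => f (toIcoMod hc 0 x), fun x => ?_, fun x hx => ?_, ?_⟩
  · simp only [toIcoMod_add_right]
  · have : toIcoMod hc 0 x = x := (toIcoMod_eq_self hc).2 (by simpa using hx)
    simp only [this]
  · filter_upwards [ae_forall_int_of_ae_periodic h] with x hx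
    have := hx (-(toIcoDiv hc 0 x))
    rw [← this, toIcoMod, zsmul_eq_mul]
    congr 1
    push_cast
    ring

end periodicity

/-! ### Diagonalization of `J` and removal of the diagonal potential. -/

section gauge

/-- The diagonal entry of the potential for the eigenvector `(1, i)` of `J`. -/
noncomputable def potentialPlus (M : Matrix (Fin 2) (Fin 2) ℂ) : ℝ :=
  ((M 0 0).re + (M 1 1).re) / 2 - (M 0 1).im

/-- The diagonal entry of the potential for the eigenvector `(1, -i)` of `J`. -/
noncomputable def potentialMinus (M : Matrix (Fin 2) (Fin 2) ℂ) : ℝ :=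
  ((M 0 0).re + (M 1 1).re) / 2 + (M 0 1).im

/-- The off-diagonal entry of the potential in the basis of eigenvectors of `J`. -/
noncomputable def potentialOff (M : Matrix (Fin 2) (Fin 2) ℂ) : ℂ :=
  ((((M 0 0).re - (M 1 1).re) / 2 : ℝ) : ℂ) - Complex.I * ((M 0 1).re : ℂ)

theorem isHermitian_entries {M : Matrix (Fin 2) (Fin 2) ℂ} (hM : M.IsHermitian) :
    M 0 0 = ((M 0 0).re : ℂ) ∧ M 1 1 = ((M 1 1).re : ℂ) ∧
      M 0 1 = ((M 0 1).re : ℂ) + ((M 0 1).im : ℂ) * Complex.I ∧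
      M 1 0 = ((M 0 1).re : ℂ) - ((M 0 1).im : ℂ) * Complex.I := by
  have h00 := hM.apply 0 0
  have h11 := hM.apply 1 1
  have h10 := hM.apply 1 0
  refine ⟨(Complex.conj_eq_iff_re.1 h00).symm, (Complex.conj_eq_iff_re.1 h11).symm,
    (Complex.re_add_im _).symm, ?_⟩
  rw [← h10]
  apply Complex.ext <;> simp

theorem eq_smul_sigma_of_potentialOff_eq_zero {M : Matrix (Fin 2) (Fin 2) ℂ}
    (hM : M.IsHermitian) (h : potentialOff M = 0) :
    M = ((M 0 0).re : ℂ) • sigma0 + ((M 0 1).im : ℂ) • sigma2 := by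
  obtain ⟨h00, h11, h01, h10⟩ := isHermitian_entries hM
  have hre := congrArg Complex.re h
  have him := congrArg Complex.im h
  simp [potentialOff] at hre him
  have e : (M 1 1).re = (M 0 0).re := by linarith
  ext i j
  fin_cases i <;> fin_cases j
  · simpa [sigma0, sigma2] using h00
  · rw [him] at h01
    simpa [sigma0, sigma2] using h01
  · rw [him] at h10
    simpa [sigma0, sigma2] using h10
  · rw [e] at h11
    simpa [sigma0, sigma2] using h11

/-- The primitive of the diagonal entry for `(1, i)`. -/
noncomputable def primitivePlus (Q : ℝ → Matrix (Fin 2) (Fin 2) ℂ) (x : ℝ) : ℂ :=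
  ∫ t in (0 : ℝ)..x, (potentialPlus (Q t) : ℂ)

/-- The primitive of the diagonal entry for `(1, -i)`. -/
noncomputable def primitiveMinus (Q : ℝ → Matrix (Fin 2) (Fin 2) ℂ) (x : ℝ) : ℂ :=
  ∫ t in (0 : ℝ)..x, (potentialMinus (Q t) : ℂ)

/-- The coefficient of the reduced system of the potential `Q`. -/
noncomputable def reducedCoefficient (Q : ℝ → Matrix (Fin 2) (Fin 2) ℂ) (x : ℝ) : ℂ :=
  Complex.I * potentialOff (Q x) *
    Complex.exp (-Complex.I * (primitivePlus Q x + primitiveMinus Q x))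

variable {Q : ℝ → Matrix (Fin 2) (Fin 2) ℂ} {T : ℝ}

theorem conj_primitivePlus (x : ℝ) : conj (primitivePlus Q x) = primitivePlus Q x := by
  rw [primitivePlus, intervalIntegral.integral_ofReal, Complex.conj_ofReal]

theorem conj_primitiveMinus (x : ℝ) : conj (primitiveMinus Q x) = primitiveMinus Q x := by
  rw [primitiveMinus, intervalIntegral.integral_ofReal, Complex.conj_ofReal]

theorem intervalIntegrable_re
    (hQ : ∀ i j, IntervalIntegrable (fun x => Q x i j) volume 0 T) (i j : Fin 2) :
    IntervalIntegrable (fun x => (Q x i j).re) volume 0 T :=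
  ⟨(hQ i j).1.re, (hQ i j).2.re⟩

theorem intervalIntegrable_im
    (hQ : ∀ i j, IntervalIntegrable (fun x => Q x i j) volume 0 T) (i j : Fin 2) :
    IntervalIntegrable (fun x => (Q x i j).im) volume 0 T :=
  ⟨(hQ i j).1.im, (hQ i j).2.im⟩

theorem IntervalIntegrable.ofReal_complex {f : ℝ → ℝ} {a b : ℝ}
    (hf : IntervalIntegrable f volume a b) :
    IntervalIntegrable (fun x => (f x : ℂ)) volume a b :=
  ⟨hf.1.ofReal, hf.2.ofReal⟩

theorem intervalIntegrable_potentialPlus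
    (hQ : ∀ i j, IntervalIntegrable (fun x => Q x i j) volume 0 T) :
    IntervalIntegrable (fun x => (potentialPlus (Q x) : ℂ)) volume 0 T :=
  IntervalIntegrable.ofReal_complex ((((intervalIntegrable_re hQ 0 0).add
    (intervalIntegrable_re hQ 1 1)).div_const 2).sub (intervalIntegrable_im hQ 0 1))

theorem intervalIntegrable_potentialMinus
    (hQ : ∀ i j, IntervalIntegrable (fun x => Q x i j) volume 0 T) :
    IntervalIntegrable (fun x => (potentialMinus (Q x) : ℂ)) volume 0 T :=
  IntervalIntegrable.ofReal_complex ((((intervalIntegrable_re hQ 0 0).add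
    (intervalIntegrable_re hQ 1 1)).div_const 2).add (intervalIntegrable_im hQ 0 1))

theorem intervalIntegrable_potentialOff
    (hQ : ∀ i j, IntervalIntegrable (fun x => Q x i j) volume 0 T) :
    IntervalIntegrable (fun x => potentialOff (Q x)) volume 0 T :=
  (IntervalIntegrable.ofReal_complex (((intervalIntegrable_re hQ 0 0).sub
    (intervalIntegrable_re hQ 1 1)).div_const 2)).sub
    ((IntervalIntegrable.ofReal_complex (intervalIntegrable_re hQ 0 1)).const_mul _)

theorem hasACDeriv_primitivePlus
    (hQ : ∀ i j, IntervalIntegrable (fun x => Q x i j) volume 0 T) :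
    HasACDeriv (primitivePlus Q) (fun x => (potentialPlus (Q x) : ℂ)) 0 T :=
  HasACDeriv.intervalIntegral (intervalIntegrable_potentialPlus hQ) left_mem_uIcc

theorem hasACDeriv_primitiveMinus
    (hQ : ∀ i j, IntervalIntegrable (fun x => Q x i j) volume 0 T) :
    HasACDeriv (primitiveMinus Q) (fun x => (potentialMinus (Q x) : ℂ)) 0 T :=
  HasACDeriv.intervalIntegral (intervalIntegrable_potentialMinus hQ) left_mem_uIcc

theorem intervalIntegrable_reducedCoefficient
    (hQ : ∀ i j, IntervalIntegrable (fun x => Q x i j) volume 0 T) :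
    IntervalIntegrable (reducedCoefficient Q) volume 0 T :=
  ((intervalIntegrable_potentialOff hQ).const_mul _).mul_continuousOn
    (((hasACDeriv_primitivePlus hQ).add (hasACDeriv_primitiveMinus hQ)).const_mul
      (-Complex.I)).cexp.continuousOn

/-- The component of a solution along the eigenvector `(1, i)` of `J` in the reduced gauge. -/
noncomputable def gaugePlus (Q : ℝ → Matrix (Fin 2) (Fin 2) ℂ) (lam : ℝ) (y₁ y₂ : ℝ → ℂ)
    (x : ℝ) : ℂ :=
  (y₁ x - Complex.I * y₂ x) * (phase lam x * Complex.exp (-Complex.I * primitivePlus Q x))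

/-- The component of a solution along the eigenvector `(1, -i)` of `J` in the reduced gauge. -/
noncomputable def gaugeMinus (Q : ℝ → Matrix (Fin 2) (Fin 2) ℂ) (lam : ℝ) (y₁ y₂ : ℝ → ℂ)
    (x : ℝ) : ℂ :=
  (y₁ x + Complex.I * y₂ x) * (conj (phase lam x) * Complex.exp (Complex.I * primitiveMinus Q x))

variable {lam : ℝ} {y₁ y₂ y₁' y₂' : ℝ → ℂ}

theorem phase_two_mul_self (lam x : ℝ) : phase (2 * lam) x = phase lam x * phase lam x := by
  rw [two_mul, phase_add]

/-- The coordinate `y₁ - i y₂` belongs to the eigenvalue `i` of `J`; the exponential factor absorbs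
`lam` and the diagonal potential, leaving only the coupling to `y₁ + i y₂`. -/
theorem hasACDeriv_gaugePlus (hQ : ∀ i j, IntervalIntegrable (fun x => Q x i j) volume 0 T)
    (hherm : ∀ᵐ x : ℝ, (Q x).IsHermitian)
    (h₁ : HasACDeriv y₁ y₁' 0 T) (h₂ : HasACDeriv y₂ y₂' 0 T)
    (heq : ∀ᵐ x : ℝ, y₁' x = Q x 1 0 * y₁ x + Q x 1 1 * y₂ x - lam * y₂ x ∧
      y₂' x = lam * y₁ x - Q x 0 0 * y₁ x - Q x 0 1 * y₂ x) :
    HasACDeriv (gaugePlus Q lam y₁ y₂)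
      (fun x => reducedCoefficient Q x * phase (2 * lam) x * gaugeMinus Q lam y₁ y₂ x) 0 T := by
  refine ((h₁.sub (h₂.const_mul Complex.I)).mul ((hasACDeriv_phase lam 0 T).mul
    ((hasACDeriv_primitivePlus hQ).const_mul (-Complex.I)).cexp)).congr_deriv ?_
  filter_upwards [heq, hherm] with x ⟨e1, e2⟩ hM _
  obtain ⟨h00, h11, h01, h10⟩ := isHermitian_entries hM
  have hFG : Complex.exp (-Complex.I * (primitivePlus Q x + primitiveMinus Q x)) *
      Complex.exp (Complex.I * primitiveMinus Q x)
      = Complex.exp (-Complex.I * primitivePlus Q x) := by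
    rw [← Complex.exp_add]
    congr 1
    ring
  have hph := phase_mul_conj lam x
  rw [e1, e2, h00, h11, h01, h10]
  simp only [reducedCoefficient, gaugeMinus, phase_two_mul_self, potentialOff, potentialPlus]
  push_cast
  -- With the exponentials as variables, the claim is a polynomial identity modulo `hFG`, `hph` and
  -- `I² = -1`.
  generalize Complex.exp (-Complex.I * (primitivePlus Q x + primitiveMinus Q x)) = F at *
  generalize Complex.exp (-Complex.I * primitivePlus Q x) = E at *
  generalize Complex.exp (Complex.I * primitiveMinus Q x) = G at *
  generalize phase lam x = p at *
  generalize conj p = p' at *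
  generalize ((Q x 0 0).re : ℂ) = q₀
  generalize ((Q x 1 1).re : ℂ) = q₁
  generalize ((Q x 0 1).re : ℂ) = s
  generalize ((Q x 0 1).im : ℂ) = u
  generalize y₁ x = z₁
  generalize y₂ x = z₂
  linear_combination
    (-(Complex.I * ((q₀ - q₁) / 2 - Complex.I * s) * p * p * p' * (z₁ + Complex.I * z₂))) * hFG
    + (-(Complex.I * ((q₀ - q₁) / 2 - Complex.I * s) * p * E * (z₁ + Complex.I * z₂))) * hph
    + p * E * (u * z₂ - (lam - ((q₀ + q₁) / 2 - u)) * z₂ - (q₀ - q₁) / 2 * z₂ + s * z₁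
      + Complex.I * s * z₂) * Complex.I_sq

theorem hasACDeriv_gaugeMinus (hQ : ∀ i j, IntervalIntegrable (fun x => Q x i j) volume 0 T)
    (hherm : ∀ᵐ x : ℝ, (Q x).IsHermitian)
    (h₁ : HasACDeriv y₁ y₁' 0 T) (h₂ : HasACDeriv y₂ y₂' 0 T)
    (heq : ∀ᵐ x : ℝ, y₁' x = Q x 1 0 * y₁ x + Q x 1 1 * y₂ x - lam * y₂ x ∧
      y₂' x = lam * y₁ x - Q x 0 0 * y₁ x - Q x 0 1 * y₂ x) :
    HasACDeriv (gaugeMinus Q lam y₁ y₂)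
      (fun x => conj (reducedCoefficient Q x * phase (2 * lam) x) * gaugePlus Q lam y₁ y₂ x)
      0 T := by
  refine ((h₁.add (h₂.const_mul Complex.I)).mul ((hasACDeriv_phase lam 0 T).conjugate.mul
    ((hasACDeriv_primitiveMinus hQ).const_mul Complex.I).cexp)).congr_deriv ?_
  filter_upwards [heq, hherm] with x ⟨e1, e2⟩ hM _
  obtain ⟨h00, h11, h01, h10⟩ := isHermitian_entries hM
  have hFG : Complex.exp (Complex.I * (primitivePlus Q x + primitiveMinus Q x)) *
      Complex.exp (-Complex.I * primitivePlus Q x)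
      = Complex.exp (Complex.I * primitiveMinus Q x) := by
    rw [← Complex.exp_add]
    congr 1
    ring
  have hph := phase_mul_conj lam x
  rw [e1, e2, h00, h11, h01, h10]
  simp only [reducedCoefficient, gaugePlus, phase_two_mul_self, potentialOff, potentialMinus,
    map_mul, map_sub, map_add, map_neg, ← Complex.exp_conj, Complex.conj_I, Complex.conj_ofReal,
    conj_primitivePlus, conj_primitiveMinus, neg_neg]
  push_cast
  generalize Complex.exp (Complex.I * (primitivePlus Q x + primitiveMinus Q x)) = F at *
  generalize Complex.exp (-Complex.I * primitivePlus Q x) = E at *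
  generalize Complex.exp (Complex.I * primitiveMinus Q x) = G at *
  generalize phase lam x = p at *
  generalize conj p = p' at *
  generalize ((Q x 0 0).re : ℂ) = q₀
  generalize ((Q x 1 1).re : ℂ) = q₁
  generalize ((Q x 0 1).re : ℂ) = s
  generalize ((Q x 0 1).im : ℂ) = u
  generalize y₁ x = z₁
  generalize y₂ x = z₂
  linear_combination
    (Complex.I * ((q₀ - q₁) / 2 + Complex.I * s) * p' * p' * p * (z₁ - Complex.I * z₂)) * hFG
    + (Complex.I * ((q₀ - q₁) / 2 + Complex.I * s) * p' * G * (z₁ - Complex.I * z₂)) * hph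
    + p' * G * (-u * z₂ + (((q₀ + q₁) / 2 + u) - lam) * z₂ - (q₀ - q₁) / 2 * z₂ + s * z₁
      - Complex.I * s * z₂) * Complex.I_sq

end gauge

/-- The Wronskian `a d₂ - b d₁` and the pairing `conj a d₁ - conj b d₂` are both conserved; with
`|a|² - |b|² = 1` they determine `d₂`, and no uniqueness theorem is needed. -/
theorem IsReducedSolution.conj_left_eq {g : ℝ → ℂ} {T lam : ℝ} {a b d₁ d₂ : ℝ → ℂ}
    (h : IsReducedSolution g T lam a b)
    (h₁ : HasACDeriv d₁ (fun x => g x * phase (2 * lam) x * d₂ x) 0 T)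
    (h₂ : HasACDeriv d₂ (fun x => conj (g x * phase (2 * lam) x) * d₁ x) 0 T)
    (h₁0 : d₁ 0 = 0) (h₂0 : d₂ 0 = 1) {x : ℝ} (hx : x ∈ uIcc 0 T) :
    d₂ x = conj (a x) := by
  have e1 := ((h.left.conjugate.mul h₁).sub
    (h.right.conjugate.mul h₂)).eqOn_left_of_deriv_eq_zero (Eventually.of_forall fun y _ => by
      simp only [map_mul, Complex.conj_conj]
      ring) x hx
  have e2 := ((h.left.mul h₂).sub (h.right.mul h₁)).eqOn_left_of_deriv_eq_zero
    (Eventually.of_forall fun y _ => by ring) x hx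
  have e3 := h.mul_conj_sub hx
  simp only [h.left_zero, h.right_zero, h₁0, h₂0] at e1 e2
  simp only [map_zero, mul_zero, sub_zero, mul_one] at e1 e2
  linear_combination conj (a x) * e2 + b x * e1 - d₂ x * e3

theorem allInstabilityIntervalsVanish_iff {Q : ℝ → Matrix (Fin 2) (Fin 2) ℂ} :
    AllInstabilityIntervalsVanish Q ↔ ∀ lam : ℝ, lam ∈ stabilitySet Q := by
  constructor
  · intro h lam
    by_contra hlam
    have : connectedComponentIn (stabilitySet Q)ᶜ lam ∈ instabilityIntervals Q := ⟨lam, hlam, rfl⟩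
    rw [AllInstabilityIntervalsVanish] at h
    rw [h] at this
    exact this
  · intro h
    refine eq_empty_of_forall_notMem ?_
    rintro I ⟨lam, hlam, -⟩
    exact hlam (h lam)

/-- The matrix equation written out in entries. -/
theorem equation_iff_entries (D M N : Matrix (Fin 2) (Fin 2) ℂ) (lam : ℂ) :
    J * D + M * N = lam • N ↔ ∀ j, D 1 j + (M 0 0 * N 0 j + M 0 1 * N 1 j) = lam * N 0 j ∧
      -D 0 j + (M 1 0 * N 0 j + M 1 1 * N 1 j) = lam * N 1 j := by
  have h00 : J 0 0 = 0 := rfl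
  have h01 : J 0 1 = 1 := rfl
  have h10 : J 1 0 = -1 := rfl
  have h11 : J 1 1 = 0 := rfl
  rw [← Matrix.ext_iff, forall_comm]
  refine forall_congr' fun j => Fin.forall_fin_two.trans ?_
  simp only [Matrix.add_apply, Matrix.mul_apply, Fin.sum_univ_two, Matrix.smul_apply, smul_eq_mul,
    h00, h01, h10, h11, zero_mul, one_mul, zero_add, add_zero, neg_mul]

/-! ### From stability to a vanishing off-diagonal potential. -/

section forward

variable {Q Y : ℝ → Matrix (Fin 2) (Fin 2) ℂ} {T lam : ℝ}

theorem IsFundamentalMatrix.hasACDeriv_column (hY : IsFundamentalMatrix Q lam Y) (k₁ k₂ : ℂ)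
    (i : Fin 2) : HasACDeriv (fun x => k₁ * Y x i 0 + k₂ * Y x i 1)
      (fun x => k₁ * deriv (fun t => Y t i 0) x + k₂ * deriv (fun t => Y t i 1) x) 0 T := by
  have h : ∀ j, HasACDeriv (fun x => Y x i j) (fun x => deriv (fun t => Y t i j) x) 0 T :=
    fun j => ⟨hY.absolutelyContinuous i j 0 T,
      ae_hasDerivAt_deriv_of_ac (hY.absolutelyContinuous i j 0 T)⟩
  exact ((h 0).const_mul k₁).add ((h 1).const_mul k₂)

theorem IsFundamentalMatrix.equation_column (hY : IsFundamentalMatrix Q lam Y) (k₁ k₂ : ℂ) :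
    ∀ᵐ x : ℝ, k₁ * deriv (fun t => Y t 0 0) x + k₂ * deriv (fun t => Y t 0 1) x
        = Q x 1 0 * (k₁ * Y x 0 0 + k₂ * Y x 0 1) + Q x 1 1 * (k₁ * Y x 1 0 + k₂ * Y x 1 1)
          - lam * (k₁ * Y x 1 0 + k₂ * Y x 1 1) ∧
      k₁ * deriv (fun t => Y t 1 0) x + k₂ * deriv (fun t => Y t 1 1) x
        = lam * (k₁ * Y x 0 0 + k₂ * Y x 0 1) - Q x 0 0 * (k₁ * Y x 0 0 + k₂ * Y x 0 1)
          - Q x 0 1 * (k₁ * Y x 1 0 + k₂ * Y x 1 1) := by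
  filter_upwards [hY.equation] with x hx
  rw [equation_iff_entries] at hx
  obtain ⟨h00, h10⟩ := hx 0
  obtain ⟨h01, h11⟩ := hx 1
  simp only [Matrix.of_apply] at h00 h01 h10 h11
  constructor
  · linear_combination -k₁ * h10 - k₂ * h11
  · linear_combination k₁ * h00 + k₂ * h01

/-- The solution with initial value on the eigenvector `(1, i)` of `J` gives the reduced solution,
and the trace of the fundamental matrix is expressed by its first component. -/
theorem IsFundamentalMatrix.exists_isReducedSolution
    (hQ : ∀ i j, IntervalIntegrable (fun x => Q x i j) volume 0 T)
    (hherm : ∀ᵐ x : ℝ, (Q x).IsHermitian) (hY : IsFundamentalMatrix Q lam Y) :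
    ∃ a b : ℝ → ℂ, IsReducedSolution (reducedCoefficient Q) T lam a b ∧
      (Y T).trace = Complex.exp (Complex.I * primitivePlus Q T) * (conj (phase lam T) * a T)
        + Complex.exp (-Complex.I * primitiveMinus Q T) * (phase lam T * conj (a T)) := by
  -- The initial vectors `(1, ±i) / 2` have gauge coordinates `(1, 0)` and `(0, 1)`.
  have h1 := fun i => hY.hasACDeriv_column (T := T) (1 / 2) (Complex.I / 2) i
  have h2 := fun i => hY.hasACDeriv_column (T := T) (1 / 2) (-Complex.I / 2) i
  have e1 := hY.equation_column (1 / 2) (Complex.I / 2)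
  have e2 := hY.equation_column (1 / 2) (-Complex.I / 2)
  have hp0 : primitivePlus Q 0 = 0 := intervalIntegral.integral_same
  have hm0 : primitiveMinus Q 0 = 0 := intervalIntegral.integral_same
  have hsol : IsReducedSolution (reducedCoefficient Q) T lam _ _ :=
    ⟨hasACDeriv_gaugePlus hQ hherm (h1 0) (h1 1) e1,
      hasACDeriv_gaugeMinus hQ hherm (h1 0) (h1 1) e1, by
        simp only [gaugePlus, hY.initial, hp0, phase_zero_right]
        simp
        linear_combination (-1 / 2 : ℂ) * Complex.I_sq, by
        simp only [gaugeMinus, hY.initial, hm0, phase_zero_right]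
        simp
        linear_combination (1 / 2 : ℂ) * Complex.I_sq⟩
  refine ⟨_, _, hsol, ?_⟩
  rw [← hsol.conj_left_eq (hasACDeriv_gaugePlus hQ hherm (h2 0) (h2 1) e2)
    (hasACDeriv_gaugeMinus hQ hherm (h2 0) (h2 1) e2) ?_ ?_ right_mem_uIcc]
  · have hph := phase_mul_conj lam T
    have hE : Complex.exp (Complex.I * primitivePlus Q T) *
        Complex.exp (-Complex.I * primitivePlus Q T) = 1 := by
      rw [← Complex.exp_add, neg_mul, add_neg_cancel, Complex.exp_zero]
    have hG : Complex.exp (-Complex.I * primitiveMinus Q T) *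
        Complex.exp (Complex.I * primitiveMinus Q T) = 1 := by
      rw [← Complex.exp_add, neg_mul, neg_add_cancel, Complex.exp_zero]
    simp only [gaugePlus, gaugeMinus, Matrix.trace_fin_two]
    generalize Complex.exp (Complex.I * primitivePlus Q T) = E at *
    generalize Complex.exp (-Complex.I * primitivePlus Q T) = E' at *
    generalize Complex.exp (Complex.I * primitiveMinus Q T) = G at *
    generalize Complex.exp (-Complex.I * primitiveMinus Q T) = G' at *
    generalize phase lam T = p at *
    generalize conj p = p' at *
    generalize Y T = M
    have r1 : E * (p' * ((1 / 2 * M 0 0 + Complex.I / 2 * M 0 1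
        - Complex.I * (1 / 2 * M 1 0 + Complex.I / 2 * M 1 1)) * (p * E')))
        = 1 / 2 * M 0 0 + Complex.I / 2 * M 0 1
        - Complex.I * (1 / 2 * M 1 0 + Complex.I / 2 * M 1 1) := by
      linear_combination (1 / 2 * M 0 0 + Complex.I / 2 * M 0 1
        - Complex.I * (1 / 2 * M 1 0 + Complex.I / 2 * M 1 1)) * (p * p' * hE + hph)
    have r2 : G' * (p * ((1 / 2 * M 0 0 + -Complex.I / 2 * M 0 1
        + Complex.I * (1 / 2 * M 1 0 + -Complex.I / 2 * M 1 1)) * (p' * G)))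
        = 1 / 2 * M 0 0 + -Complex.I / 2 * M 0 1
        + Complex.I * (1 / 2 * M 1 0 + -Complex.I / 2 * M 1 1) := by
      linear_combination (1 / 2 * M 0 0 + -Complex.I / 2 * M 0 1
        + Complex.I * (1 / 2 * M 1 0 + -Complex.I / 2 * M 1 1)) * (p * p' * hG + hph)
    rw [r1, r2]
    linear_combination M 1 1 * Complex.I_sq
  · simp only [gaugePlus, hY.initial, hp0, phase_zero_right]
    simp
    linear_combination (1 / 2 : ℂ) * Complex.I_sq
  · simp only [gaugeMinus, hY.initial, hm0, phase_zero_right]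
    simp
    linear_combination (-1 / 2 : ℂ) * Complex.I_sq

/-- A sum of two conjugate numbers up to a common unimodular factor. -/
theorem norm_exp_mul_add_exp_mul_conj (α β : ℝ) (z : ℂ) :
    ‖Complex.exp (Complex.I * α) * z + Complex.exp (-Complex.I * β) * conj z‖
      = 2 * |(phase ((α + β) / 2) 1 * z).re| := by
  have e1 : Complex.exp (Complex.I * α) = phase ((α - β) / 2) 1 * phase ((α + β) / 2) 1 := by
    rw [← phase_add, phase]
    congr 1
    push_cast
    ring
  have e2 : Complex.exp (-Complex.I * β)
      = phase ((α - β) / 2) 1 * conj (phase ((α + β) / 2) 1) := by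
    rw [phase, phase, ← Complex.exp_conj, ← Complex.exp_add, map_mul, Complex.conj_ofReal,
      Complex.conj_I]
    congr 1
    push_cast
    ring
  rw [e1, e2, mul_assoc, mul_assoc, ← mul_add, ← map_mul, norm_mul, norm_phase, one_mul,
    Complex.add_conj, Complex.norm_real, Real.norm_eq_abs, abs_mul]
  norm_num

theorem potentialOff_eq_zero_of_stable (hT : 0 < T)
    (hQ : ∀ i j, IntervalIntegrable (fun x => Q x i j) volume 0 T)
    (hherm : ∀ᵐ x : ℝ, (Q x).IsHermitian)
    (hstab : ∀ lam : ℝ, ∃ Y, IsFundamentalMatrix Q lam Y ∧ ‖(Y T).trace‖ ≤ 2) :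
    ∀ᵐ x : ℝ, x ∈ Ioo 0 T → potentialOff (Q x) = 0 := by
  have h : ∀ lam : ℝ, ∃ a b : ℝ → ℂ, IsReducedSolution (reducedCoefficient Q) T lam a b ∧
      |(phase (((∫ t in (0 : ℝ)..T, potentialPlus (Q t)) +
        ∫ t in (0 : ℝ)..T, potentialMinus (Q t)) / 2) 1 * (conj (phase lam T) * a T)).re| ≤ 1 := by
    intro lam
    obtain ⟨Y, hY, hle⟩ := hstab lam
    obtain ⟨a, b, hab, htr⟩ := hY.exists_isReducedSolution hQ hherm
    refine ⟨a, b, hab, ?_⟩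
    have e : phase lam T * conj (a T) = conj (conj (phase lam T) * a T) := by simp
    rw [htr, e, primitivePlus, primitiveMinus, intervalIntegral.integral_ofReal,
      intervalIntegral.integral_ofReal, norm_exp_mul_add_exp_mul_conj] at hle
    linarith
  -- The solutions are chosen separately for each `lam`; their continuity in `lam` follows from the
  -- transfer identities.
  choose a b hab hle using h
  filter_upwards [IsReducedSolution.coefficient_eq_zero_of_abs_re_le_one hab hT
    (intervalIntegrable_reducedCoefficient hQ) _ hle] with x hx hx'
  simpa [reducedCoefficient, Complex.exp_ne_zero] using hx hx'

end forward

/-! ### Explicit solutions for `r σ₀ + q σ₂`. -/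

section backward

variable {Q : ℝ → Matrix (Fin 2) (Fin 2) ℂ} {r q : ℝ → ℝ}

/-- The explicit exponentials solving the system with potential `r σ₀ + q σ₂`. -/
noncomputable def explicitExp (r q : ℝ → ℝ) (lam ε : ℝ) (x : ℝ) : ℂ :=
  Complex.exp (Complex.I * (ε * (lam * x - ∫ t in (0 : ℝ)..x, (r t : ℂ))
    - ∫ t in (0 : ℝ)..x, (q t : ℂ)))

theorem norm_explicitExp (lam ε x : ℝ) : ‖explicitExp r q lam ε x‖ = 1 := by
  rw [explicitExp, intervalIntegral.integral_ofReal, intervalIntegral.integral_ofReal, mul_comm]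
  exact_mod_cast Complex.norm_exp_ofReal_mul_I _

theorem hasACDeriv_explicitExp (hr : ∀ a b, IntervalIntegrable r volume a b)
    (hq : ∀ a b, IntervalIntegrable q volume a b) (lam ε a b : ℝ) :
    HasACDeriv (explicitExp r q lam ε)
      (fun x => explicitExp r q lam ε x * (Complex.I * (ε * (lam - r x) - q x))) a b := by
  -- The interval is enlarged to contain the base point `0` of the primitives.
  have hsub : uIcc a b ⊆ uIcc (min 0 (min a b)) (max 0 (max a b)) := by
    rw [uIcc_of_le (a := min 0 _) ((min_le_left _ _).trans (le_max_left _ _))]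
    exact Icc_subset_Icc (min_le_right _ _) (le_max_right _ _)
  have h0 : (0 : ℝ) ∈ uIcc (min 0 (min a b)) (max 0 (max a b)) := by
    rw [uIcc_of_le ((min_le_left _ _).trans (le_max_left _ _))]
    exact ⟨min_le_left _ _, le_max_left _ _⟩
  refine HasACDeriv.mono ?_ hsub
  have hx : HasACDeriv (fun x : ℝ => (lam : ℂ) * x) (fun _ => (lam : ℂ))
      (min 0 (min a b)) (max 0 (max a b)) :=
    HasACDeriv.of_hasDerivAt (fun x => by
      simpa using (hasDerivAt_id x).ofReal_comp.const_mul (lam : ℂ)) continuous_const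
  exact (((hx.sub (HasACDeriv.intervalIntegral (IntervalIntegrable.ofReal_complex (hr _ _))
    h0)).const_mul ε).sub (HasACDeriv.intervalIntegral
    (IntervalIntegrable.ofReal_complex (hq _ _)) h0)).const_mul Complex.I |>.cexp

theorem HasACDeriv.ae_hasDerivAt {u u' : ℝ → ℂ} (h : ∀ a b, HasACDeriv u u' a b) :
    ∀ᵐ x : ℝ, HasDerivAt u (u' x) x := by
  filter_upwards [ae_all_iff.2 fun n : ℕ => (h (-n) n).deriv] with x hx
  obtain ⟨n, hn⟩ := exists_nat_ge |x|
  refine hx n ?_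
  rw [uIcc_of_le (by linarith [abs_nonneg x])]
  exact abs_le.1 hn

/-- With `θ = lam x - ∫ r` and `s = ∫ q`, the solution is `e^{-is}` times the rotation by `θ`. Its
trace is `e^{i(θ - s)} + e^{-i(θ + s)}`. -/
theorem exists_isFundamentalMatrix (hr : ∀ a b, IntervalIntegrable r volume a b)
    (hq : ∀ a b, IntervalIntegrable q volume a b)
    (hQ : ∀ᵐ x : ℝ, Q x = (r x : ℂ) • sigma0 + (q x : ℂ) • sigma2) (lam T : ℝ) :
    ∃ Y, IsFundamentalMatrix Q lam Y ∧ ‖(Y T).trace‖ ≤ 2 := by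
  have hp := hasACDeriv_explicitExp hr hq lam 1
  have hm := hasACDeriv_explicitExp hr hq lam (-1)
  have hC := fun a b => ((hp a b).add (hm a b)).const_mul (1 / 2)
  have hS := fun a b => ((hp a b).sub (hm a b)).const_mul (Complex.I / 2)
  have hS' := fun a b => ((hp a b).sub (hm a b)).const_mul (-(Complex.I / 2))
  set P := explicitExp r q lam 1 with hP
  set N := explicitExp r q lam (-1) with hN
  have hP0 : P 0 = 1 := by simp [hP, explicitExp]
  have hN0 : N 0 = 1 := by simp [hN, explicitExp]
  refine ⟨fun x => !![1 / 2 * (P x + N x), Complex.I / 2 * (P x - N x);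
    -(Complex.I / 2) * (P x - N x), 1 / 2 * (P x + N x)], ⟨?_, ?_, ?_⟩, ?_⟩
  · rw [hP0, hN0, Matrix.one_fin_two]
    norm_num
  · intro i j a b
    fin_cases i <;> fin_cases j
    · exact (hC a b).ac
    · exact (hS a b).ac
    · exact (hS' a b).ac
    · exact (hC a b).ac
  · filter_upwards [HasACDeriv.ae_hasDerivAt hC, HasACDeriv.ae_hasDerivAt hS,
      HasACDeriv.ae_hasDerivAt hS', hQ] with x h1 h2 h3 h4
    have d1 := h1.deriv
    have d2 := h2.deriv
    have d3 := h3.deriv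
    have m00 : ((r x : ℂ) • sigma0 + (q x : ℂ) • sigma2) 0 0 = r x := by simp [sigma0, sigma2]
    have m01 : ((r x : ℂ) • sigma0 + (q x : ℂ) • sigma2) 0 1 = q x * Complex.I := by
      simp [sigma0, sigma2]
    have m10 : ((r x : ℂ) • sigma0 + (q x : ℂ) • sigma2) 1 0 = -(q x * Complex.I) := by
      simp [sigma0, sigma2]
    have m11 : ((r x : ℂ) • sigma0 + (q x : ℂ) • sigma2) 1 1 = r x := by simp [sigma0, sigma2]
    rw [h4, equation_iff_entries, m00, m01, m10, m11]
    refine Fin.forall_fin_two.2 ⟨⟨?_, ?_⟩, ⟨?_, ?_⟩⟩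
    · change deriv (fun t => -(Complex.I / 2) * (P t - N t)) x + (r x * (1 / 2 * (P x + N x))
        + q x * Complex.I * (-(Complex.I / 2) * (P x - N x))) = lam * (1 / 2 * (P x + N x))
      rw [d3]
      push_cast
      linear_combination (-(1 / 2) * (P x * (lam - r x - q x) + N x * (lam - r x + q x))
        - q x / 2 * (P x - N x)) * Complex.I_sq
    · change -deriv (fun t => 1 / 2 * (P t + N t)) x + (-(q x * Complex.I) * (1 / 2 * (P x + N x))
        + r x * (-(Complex.I / 2) * (P x - N x))) = lam * (-(Complex.I / 2) * (P x - N x))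
      rw [d1]
      push_cast
      ring
    · change deriv (fun t => 1 / 2 * (P t + N t)) x + (r x * (Complex.I / 2 * (P x - N x))
        + q x * Complex.I * (1 / 2 * (P x + N x))) = lam * (Complex.I / 2 * (P x - N x))
      rw [d1]
      push_cast
      ring
    · change -deriv (fun t => Complex.I / 2 * (P t - N t)) x + (-(q x * Complex.I) *
        (Complex.I / 2 * (P x - N x)) + r x * (1 / 2 * (P x + N x))) = lam * (1 / 2 * (P x + N x))
      rw [d2]
      push_cast
      linear_combination (-(1 / 2) * (P x * (lam - r x - q x) + N x * (lam - r x + q x))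
        - q x / 2 * (P x - N x)) * Complex.I_sq
  · rw [Matrix.trace_fin_two]
    have e : 1 / 2 * (P T + N T) + 1 / 2 * (P T + N T) = P T + N T := by ring
    simp only [Matrix.of_apply, Matrix.cons_val', Matrix.cons_val_zero, Matrix.cons_val_one,
      Matrix.cons_val_fin_one, e]
    refine (norm_add_le _ _).trans ?_
    rw [hP, hN, norm_explicitExp, norm_explicitExp]
    norm_num

end backward

end DiracSystem

/-! ### The equivalence. -/

theorem corollary5p4 (Q : ℝ → Matrix (Fin 2) (Fin 2) ℂ)
    (hherm : ∀ᵐ x : ℝ, (Q x).IsHermitian)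
    (hper : ∀ᵐ x : ℝ, Q (x + Real.pi) = Q x)
    (hint : ∀ i j : Fin 2, IntegrableOn (fun x => Q x i j) (Set.Ico 0 Real.pi) volume) :
    DiracSystem.AllInstabilityIntervalsVanish Q ↔
      ∃ r q : ℝ → ℝ,
        IntegrableOn r (Set.Ico 0 Real.pi) volume ∧
        IntegrableOn q (Set.Ico 0 Real.pi) volume ∧
        ∀ᵐ x : ℝ, Q x = (r x : ℂ) • DiracSystem.sigma0 + (q x : ℂ) • DiracSystem.sigma2 := by
  open DiracSystem in
  rw [allInstabilityIntervalsVanish_iff]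
  constructor
  · intro h
    have hQ : ∀ i j, IntervalIntegrable (fun x => Q x i j) volume 0 Real.pi := fun i j =>
      (intervalIntegrable_iff_integrableOn_Ico_of_le Real.pi_pos.le).2 (hint i j)
    have h0 := potentialOff_eq_zero_of_stable Real.pi_pos hQ hherm fun lam => by
      obtain ⟨d, ⟨Y, hY, rfl⟩, hd⟩ := h lam
      exact ⟨Y, hY, hd⟩
    refine ⟨fun x => (Q x 0 0).re, fun x => (Q x 0 1).im, (hint 0 0).re, (hint 0 1).im, ?_⟩
    filter_upwards [hherm, ae_of_ae_Ioo_of_ae_periodic (p := fun M => potentialOff M = 0)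
      Real.pi_pos hper h0] with x h1 h2 using eq_smul_sigma_of_potentialOff_eq_zero h1 h2
  · rintro ⟨r, q, hr, hq, hrq⟩ lam
    have hentry : ∀ᵐ x : ℝ, r x = (Q x 0 0).re ∧ q x = (Q x 0 1).im := by
      filter_upwards [hrq] with x hx
      rw [hx]
      simp [sigma0, sigma2]
    -- Integrability of `r` and `q` is given on one period only. They inherit almost everywhere
    -- periodicity from `Q`, and an exactly periodic modification is integrable on every bounded
    -- interval.
    have hpair : ∀ᵐ x : ℝ, (fun x => (r x, q x)) (x + Real.pi) = (fun x => (r x, q x)) x := by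
      filter_upwards [hper, hentry, ae_add_right hentry Real.pi] with x h1 h2 h3
      rw [h3.1, h3.2, h1, h2.1, h2.2]
    obtain ⟨F, hFper, hFeq, hFae⟩ := exists_periodic_ae_eq (f := fun x => (r x, q x)) Real.pi_pos hpair
    have hF1 : ∀ a b, IntervalIntegrable (fun x => (F x).1) volume a b := by
      refine Function.Periodic.intervalIntegrable₀ (T := Real.pi) (fun x => by
        simp only [hFper x]) Real.pi_ne_zero ?_
      refine (intervalIntegrable_iff_integrableOn_Ico_of_le Real.pi_pos.le).2 (hr.congr_fun
        (fun x hx => ?_) measurableSet_Ico)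
      simp only [hFeq hx]
    have hF2 : ∀ a b, IntervalIntegrable (fun x => (F x).2) volume a b := by
      refine Function.Periodic.intervalIntegrable₀ (T := Real.pi) (fun x => by
        simp only [hFper x]) Real.pi_ne_zero ?_
      refine (intervalIntegrable_iff_integrableOn_Ico_of_le Real.pi_pos.le).2 (hq.congr_fun
        (fun x hx => ?_) measurableSet_Ico)
      simp only [hFeq hx]
    obtain ⟨Y, hY, hle⟩ := exists_isFundamentalMatrix (Q := Q) hF1 hF2 (by
      filter_upwards [hrq, hFae] with x h1 h2
      rw [h1, h2]) lam Real.pi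
    exact ⟨_, ⟨Y, hY, rfl⟩, hle⟩
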